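/- Let $\lambda,\lambda',\xi,\xi',\gamma,\rho,p,b,c,\mu\in\mathbb{C}$ with $\Re(\gamma)\ge -1$, let $a\in\mathbb{N}$ (the value $0$ is allowed), let $\eta>0$ and $\alpha>0$ be real, and let $x>0$. Generalized Struve function: $${}_a\mathcal{W}^{\alpha,\mu}_{p,b,c,\eta}(z)=\sum_{k=0}^\infty\frac{(-c)^k}{\Gamma(\alpha k+\mu)\,\Gamma\!\left(ak+\frac p\eta+\frac{b+2}2\right)}\left(\frac z2\right)^{2k+p+1},$$ with $1/\Gamma=0$ at the poles of $\Gamma$. Right-sided Marichev–Saigo–Maeda operators: for $\Re(\gamma)>0$, $$\bigl(I_-^{\lambda,\lambda',\xi,\xi',\gamma}f\bigr)(x)=\frac{x^{-\lambda'}}{\Gamma(\gamma)}\int_x^\infty (t-x)^{\gamma-1}t^{-\lambda}F_3\!\left(\lambda,\lambda',\xi,\xi';\gamma;1-\frac xt,1-\frac tx\right)f(t)\,dt,$$ where $F_3(a,a',b,b';c;X,Y)=\sum_{m,n\ge0}\frac{(a)_m(a')_n(b)_m(b')_n}{(c)_{m+n}}\frac{X^mY^n}{m!\,n!}$ is Appell's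 function, continued analytically to $|X|<1$, $Y<0$. For $\Re(\gamma)\ge-1$, with $n=[\Re(\gamma)]+1$ and $[\,\cdot\,]$ the floor, $$\bigl(D_-^{\lambda,\lambda',\xi,\xi',\gamma}f\bigr)(x)=\left(-\frac{d}{dx}\right)^{n}\bigl(I_-^{-\lambda',-\lambda,-\xi',-\xi+n,-\gamma+n}f\bigr)(x).$$ Fox–Wright function: $${}_r\Psi_s\!\left[\begin{matrix}(a_i,\alpha_i)_{1,r}\\(b_j,\beta_j)_{1,s}\end{matrix};z\right]=\sum_{k=0}^\infty\frac{\prod_{i}\Gamma(a_i+\alpha_ik)}{\prod_{j}\Gamma(b_j+\beta_jk)}\frac{z^k}{k!}.$$ Theorem. Let $f(t)=t^{-\rho}\,{}_a\mathcal{W}^{\alpha,\mu}_{p,b,c,\eta}(1/t)$, $t>0$. Suppose that the integral defining $\bigl(I_-^{-\lambda',-\lambda,-\xi',-\xi+n,-\gamma+n}f\bigr)(y)$ converges absolutely for all $y$ in a neighbourhood of $x$, and that no Gamma factor in the numerators of the Fox–Wright series below is evaluated at a pole. Then $I_-^{-\lambda',-\lambda,-\xi',-\xi+n,-\gamma+n}f$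 is of class $C^n$ near $x$, the Fox–Wright series below converges absolutely, and $$\bigl(D_-^{\lambda,\lambda',\xi,\xi',\gamma}f\bigr)(x)=\frac{x^{\lambda+\lambda'-\gamma-\rho-p-1}}{2^{p+1}}\;{}_4\Psi_5\!\left[\begin{matrix}(1,1),\ (\xi'+\rho+p+1,2),\ (-\lambda-\lambda'+\gamma+\rho+p+1,2),\ (-\lambda'-\xi+\gamma+\rho+p+1,2)\\ (\mu,\alpha),\ \left(\frac p\eta+\frac{b+2}2,a\right),\ (\rho+p+1,2),\ (-\lambda'+\xi'+\rho+p+1,2),\ (-\lambda-\lambda'-\xi+\gamma+\rho+p+1,2)\end{matrix};\,-\frac{c}{4x^2}\right].$$ -/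

import Mathlib

open Filter Topology MeasureTheory Set

noncomputable section

/-- The generalized Struve function
`∑ k, (-c)^k / (Γ(α k + μ) Γ(a k + p/η + (b+2)/2)) * (z/2)^(2k+p+1)`
(principal branch of the complex power; `1/Γ` is `0` at the poles of `Γ`). -/
def genStruve (a : ℕ) (p b c : ℂ) (η α : ℝ) (μ : ℂ) (z : ℂ) : ℂ :=
  ∑' k : ℕ, (-c) ^ k /
      (Complex.Gamma ((α : ℂ) * k + μ) *
        Complex.Gamma ((a : ℂ) * k + p / (η : ℂ) + (b + 2) / 2)) *
    (z / 2) ^ (2 * (k : ℂ) + p + 1)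

/-- The `k`-th term of the Fox–Wright series with upper parameters `A i = (a_i, α_i)` and lower
parameters `B j = (b_j, β_j)`. -/
def foxWrightTerm {m n : ℕ} (A : Fin m → ℂ × ℝ) (B : Fin n → ℂ × ℝ) (z : ℂ) (k : ℕ) : ℂ :=
  (∏ i, Complex.Gamma ((A i).1 + ((A i).2 : ℂ) * k)) /
      (∏ j, Complex.Gamma ((B j).1 + ((B j).2 : ℂ) * k)) *
    (z ^ k / (k.factorial : ℂ))

/-- The Fox–Wright function `ₘΨₙ`. -/
def foxWright {m n : ℕ} (A : Fin m → ℂ × ℝ) (B : Fin n → ℂ × ℝ) (z : ℂ) : ℂ :=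
  ∑' k : ℕ, foxWrightTerm A B z k

/-- No Gamma factor in the numerators of the Fox–Wright series is evaluated at a pole. -/
def FoxWrightDefined {m : ℕ} (A : Fin m → ℂ × ℝ) : Prop :=
  ∀ (i : Fin m) (k l : ℕ), (A i).1 + ((A i).2 : ℂ) * k ≠ -(l : ℂ)

/-- The principal branch of the Gauss hypergeometric function on `{‖z‖ < 1} ∪ {re z < 1/2}`:
the hypergeometric series on the unit disc, and outside the disc its analytic continuation
`(1 - z)^(-a) ₂F₁(a, c - b; c; z / (z - 1))`, where `‖z / (z - 1)‖ < 1` since `re z < 1/2`. -/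
def gaussF (a b c z : ℂ) : ℂ :=
  if ‖z‖ < 1 then ₂F₁ a b c z else (1 - z) ^ (-a) * ₂F₁ a (c - b) c (z / (z - 1))

/-- Appell's function
`F₃(a, a', b, b'; c; X, Y) = ∑ (a)_m (a')_n (b)_m (b')_n / ((c)_(m+n) m! n!) X^m Y^n`.
Since `(c)_(m+n) = (c)_m (c+m)_n`, the sum over `n` is `₂F₁(a', b'; c + m; Y)`; with the continued
Gauss function in its place this is the analytic continuation of `F₃` to `‖X‖ < 1` and `‖Y‖ < 1` or
`re Y < 1/2`. -/
def appellF3 (a a' b b' c X Y : ℂ) : ℂ :=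
  ∑' m : ℕ, (ascPochhammer ℂ m).eval a * (ascPochhammer ℂ m).eval b /
      ((ascPochhammer ℂ m).eval c * (m.factorial : ℂ)) * X ^ m * gaussF a' b' (c + m) Y

/-- The integrand of the right-sided Marichev–Saigo–Maeda integral at the point `x`. For `t > x > 0`
the arguments of `F₃` satisfy `0 < 1 - x/t < 1` and `1 - t/x < 0`. -/
def rightMSMIntegrand (lam lam' ξ ξ' γ : ℂ) (f : ℝ → ℂ) (x t : ℝ) : ℂ :=
  ((t - x : ℝ) : ℂ) ^ (γ - 1) * (t : ℂ) ^ (-lam) *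
    appellF3 lam lam' ξ ξ' γ ((1 - x / t : ℝ) : ℂ) ((1 - t / x : ℝ) : ℂ) * f t

/-- The right-sided Marichev–Saigo–Maeda fractional integral (for `re γ > 0` and `x > 0`). -/
def rightMSMIntegral (lam lam' ξ ξ' γ : ℂ) (f : ℝ → ℂ) (x : ℝ) : ℂ :=
  (x : ℂ) ^ (-lam') / Complex.Gamma γ * ∫ t in Ioi x, rightMSMIntegrand lam lam' ξ ξ' γ f x t

/-- The order `[re γ] + 1` of differentiation (a natural number for `re γ ≥ -1`). -/
def msmOrder (γ : ℂ) : ℕ := (⌊γ.re⌋ + 1).toNat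

/-- The fractional integral that is differentiated in the right-sided fractional derivative. -/
def rightMSMDerivIntegral (lam lam' ξ ξ' γ : ℂ) (f : ℝ → ℂ) : ℝ → ℂ :=
  rightMSMIntegral (-lam') (-lam) (-ξ') (-ξ + msmOrder γ) (-γ + msmOrder γ) f

/-- The integral defining `rightMSMDerivIntegral` converges absolutely at the point `x`. -/
def RightMSMDerivIntegrable (lam lam' ξ ξ' γ : ℂ) (f : ℝ → ℂ) (x : ℝ) : Prop :=
  IntegrableOn
    (rightMSMIntegrand (-lam') (-lam) (-ξ') (-ξ + msmOrder γ) (-γ + msmOrder γ) f x) (Ioi x)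

/-- The right-sided Marichev–Saigo–Maeda fractional derivative: `(-d/dx)^([re γ] + 1)` of the
fractional integral `rightMSMDerivIntegral`. -/
def rightMSMDeriv (lam lam' ξ ξ' γ : ℂ) (f : ℝ → ℂ) (x : ℝ) : ℂ :=
  (-1) ^ msmOrder γ * iteratedDeriv (msmOrder γ) (rightMSMDerivIntegral lam lam' ξ ξ' γ f) x

/-- Upper parameters of the Fox–Wright function in the image formula. -/
def struveUpper (lam lam' ξ ξ' γ ρ p : ℂ) : Fin 4 → ℂ × ℝ :=
  ![(1, 1),
    (ξ' + ρ + p + 1, 2),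
    (-lam - lam' + γ + ρ + p + 1, 2),
    (-lam' - ξ + γ + ρ + p + 1, 2)]

/-- Lower parameters of the Fox–Wright function in the image formula. -/
def struveLower (lam lam' ξ ξ' γ ρ : ℂ) (a : ℕ) (p b : ℂ) (η α : ℝ) (μ : ℂ) : Fin 5 → ℂ × ℝ :=
  ![(μ, α),
    (p / (η : ℂ) + (b + 2) / 2, (a : ℝ)),
    (ρ + p + 1, 2),
    (-lam' + ξ' + ρ + p + 1, 2),
    (-lam - lam' - ξ + γ + ρ + p + 1, 2)]

end

open Filter Topology MeasureTheory Set

noncomputable section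

/-! Expand `f` as a series `∑ D k * t ^ (-(s + 2 k))` with `s = ρ + p + 1`. Under `t = y u` the
fractional integral of a power is that power of `y`, shifted, times a moment `∫ K(u) u ^ (-s)` over
`u > 1` of a kernel independent of `y`. So everything rests on the moments of `K`, on exchanging sum
and integral, and on differentiating a series of powers term by term.

Moments: Pfaff's transformation (`pfaff`) turns the second argument `1 - u` of `F₃` into the first
one, `1 - 1 / u`, so `F₃` becomes `u ^ (-a')` times a double series in powers of `1 - 1 / u`
(`appellF3_eq`). Each term contributes a Beta integral, and two applications of Gauss's summation
theorem (`hasSum_gaussTerm`, `hasSum_doubleTerm`) sum the result when `re s` is large. Multiplied by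
entire reciprocal Gamma factors, the formula continues analytically to every exponent whose moment
converges absolutely, boundary line included (`integral_msmKernel_mul_inv_Gamma`).

Exchange: for large `t` the series `f` is comparable to its first nonzero term, so absolute
convergence for `f` forces that of the leading moment, and this dominates all later ones
(`rightMSMIntegral_tsum`).

Differentiation: `(-d/dy)^n` multiplies `y ^ (-(e + 2 k))` by `(e + 2 k)_n` and lowers the exponent
by `n`. The identity `1 / Γ(z) = (z)_n / Γ(z + n)` absorbs this factor, which gives the stated Gamma
quotient. -/

/-! ### Pochhammer symbols and shifts of the Gamma function. -/

/-- The Pochhammer symbol `(a)_n`. -/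
def poch {K : Type*} [Semiring K] (a : K) (n : ℕ) : K := (ascPochhammer K n).eval a

@[simp]
theorem poch_zero {K : Type*} [Semiring K] (a : K) : poch a 0 = 1 := by simp [poch]

theorem poch_succ {K : Type*} [Semiring K] (a : K) (n : ℕ) :
    poch a (n + 1) = poch a n * (a + n) := by
  simp [poch, ascPochhammer_succ_eval]

theorem poch_add {K : Type*} [CommSemiring K] (a : K) (m n : ℕ) :
    poch a (m + n) = poch a m * poch (a + m) n := by
  induction n with
  | zero => simp
  | succ n ih => rw [← add_assoc, poch_succ, ih, poch_succ]; push_cast; ring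

theorem poch_nonneg {a : ℝ} (ha : 0 ≤ a) (n : ℕ) : 0 ≤ poch a n := by
  induction n with
  | zero => simp
  | succ n ih => rw [poch_succ]; positivity

theorem poch_pos {a : ℝ} (ha : 0 < a) (n : ℕ) : 0 < poch a n := by
  induction n with
  | zero => simp
  | succ n ih => rw [poch_succ]; positivity

theorem poch_mono {a b : ℝ} (ha : 0 ≤ a) (hab : a ≤ b) (n : ℕ) : poch a n ≤ poch b n := by
  induction n with
  | zero => simp
  | succ n ih =>
    rw [poch_succ, poch_succ]
    exact mul_le_mul ih (by linarith) (by positivity) (poch_nonneg (ha.trans hab) n)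

theorem norm_poch_le {a : ℂ} {r : ℝ} (ha : ‖a‖ ≤ r) (n : ℕ) : ‖poch a n‖ ≤ poch r n := by
  induction n with
  | zero => simp
  | succ n ih =>
    rw [poch_succ, poch_succ, norm_mul]
    have h : ‖a + n‖ ≤ r + n := (norm_add_le _ _).trans (by simpa using ha)
    exact mul_le_mul ih h (norm_nonneg _) (poch_nonneg ((norm_nonneg a).trans ha) n)

theorem poch_re_le_norm {c : ℂ} (hc : 0 < c.re) (n : ℕ) : poch c.re n ≤ ‖poch c n‖ := by
  induction n with
  | zero => simp
  | succ n ih =>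
    rw [poch_succ, poch_succ, norm_mul]
    have h : c.re + n ≤ ‖c + n‖ := by simpa using Complex.re_le_norm (c + n)
    exact mul_le_mul ih h (by positivity) (norm_nonneg _)

theorem poch_ne_zero {c : ℂ} (hc : 0 < c.re) (n : ℕ) : poch c n ≠ 0 :=
  norm_pos_iff.1 ((poch_pos hc n).trans_le (poch_re_le_norm hc n))

theorem ofReal_poch (a : ℝ) (n : ℕ) : ((poch a n : ℝ) : ℂ) = poch (a : ℂ) n := by
  induction n with
  | zero => simp
  | succ n ih => rw [poch_succ, poch_succ]; push_cast; rw [ih]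

/-- `1 / Γ(z) = (z)_n / Γ(z + n)`, also at the poles of `Γ`. -/
theorem inv_Gamma_eq_poch_mul (z : ℂ) (n : ℕ) :
    (Complex.Gamma z)⁻¹ = poch z n * (Complex.Gamma (z + n))⁻¹ := by
  induction n with
  | zero => simp
  | succ n ih =>
    rw [ih, Complex.one_div_Gamma_eq_self_mul_one_div_Gamma_add_one (z + n), poch_succ]
    push_cast
    rw [mul_assoc, add_assoc z]

theorem Gamma_add_nat {z : ℂ} (hz : 0 < z.re) (n : ℕ) :
    Complex.Gamma (z + n) = poch z n * Complex.Gamma z := by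
  have h := inv_Gamma_eq_poch_mul z n
  have h1 := Complex.Gamma_ne_zero_of_re_pos hz
  have h2 : Complex.Gamma (z + n) ≠ 0 := Complex.Gamma_ne_zero_of_re_pos (by simp; positivity)
  field_simp at h
  rw [h, mul_comm]

theorem realGamma_add_nat {z : ℝ} (hz : 0 < z) (n : ℕ) :
    Real.Gamma (z + n) = poch z n * Real.Gamma z := by
  have h := Gamma_add_nat (z := (z : ℂ)) (by simpa using hz) n
  rw [← ofReal_poch, Complex.Gamma_ofReal, ← Complex.ofReal_natCast, ← Complex.ofReal_add,
    Complex.Gamma_ofReal] at h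
  exact_mod_cast h

/-! ### Gauss's summation theorem. -/

/-- The `n`-th term of the regularized Gauss series at `1`. -/
def gaussTerm (a b c : ℂ) (n : ℕ) : ℂ :=
  poch a n * poch b n / (n.factorial * Complex.Gamma (c + n))

/-- The `n`-th term of the regularized Gauss series at `1` with real parameters. -/
def realGaussTerm (a b c : ℝ) (n : ℕ) : ℝ :=
  poch a n * poch b n / (n.factorial * Real.Gamma (c + n))

theorem ofReal_realGaussTerm (a b c : ℝ) (n : ℕ) :
    ((realGaussTerm a b c n : ℝ) : ℂ) = gaussTerm a b c n := by
  simp only [realGaussTerm, gaussTerm]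
  push_cast
  rw [ofReal_poch, ofReal_poch, ← Complex.Gamma_ofReal]
  push_cast
  rfl

theorem realGaussTerm_nonneg {a b c : ℝ} (ha : 0 ≤ a) (hb : 0 ≤ b) (hc : 0 < c) (n : ℕ) :
    0 ≤ realGaussTerm a b c n := by
  have := poch_nonneg ha n
  have := poch_nonneg hb n
  have : 0 < Real.Gamma (c + n) := Real.Gamma_pos_of_pos (by positivity)
  unfold realGaussTerm
  positivity

theorem gaussTerm_add_one {c : ℂ} (hc : 0 < c.re) (a b : ℂ) (n : ℕ) :
    gaussTerm a b c n = (c + n) * gaussTerm a b (c + 1) n := by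
  have h0 : c + n ≠ 0 := fun h => by
    have := congrArg Complex.re h
    simp at this
    have : (0 : ℝ) ≤ n := by positivity
    linarith
  unfold gaussTerm
  rw [add_right_comm c 1, Complex.Gamma_add_one _ h0]
  have : Complex.Gamma (c + n) ≠ 0 := Complex.Gamma_ne_zero_of_re_pos (by simp; positivity)
  have : (n.factorial : ℂ) ≠ 0 := by exact_mod_cast n.factorial_ne_zero
  field_simp

theorem succ_mul_gaussTerm_succ (a b c : ℂ) (n : ℕ) :
    ((n + 1 : ℕ) : ℂ) * gaussTerm a b c (n + 1) =
      (a + n) * (b + n) * gaussTerm a b (c + 1) n := by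
  unfold gaussTerm
  rw [poch_succ, poch_succ, Nat.factorial_succ]
  have : (n.factorial : ℂ) ≠ 0 := by exact_mod_cast n.factorial_ne_zero
  have : ((n : ℂ) + 1) ≠ 0 := by exact_mod_cast n.succ_ne_zero
  push_cast
  rw [show c + (n + 1 : ℂ) = c + 1 + n by ring]
  by_cases h : Complex.Gamma (c + 1 + n) = 0
  · simp [h]
  field_simp

/-- The right side telescopes in `n`, so summation turns this into a recurrence in `c` for the value
of the series. -/
theorem gaussTerm_telescope {c : ℂ} (hc : 0 < c.re) (a b : ℂ) (n : ℕ) :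
    (c - a - b) * gaussTerm a b c n - (c - a) * (c - b) * gaussTerm a b (c + 1) n =
      n * gaussTerm a b c n - ((n + 1 : ℕ) : ℂ) * gaussTerm a b c (n + 1) := by
  rw [succ_mul_gaussTerm_succ, gaussTerm_add_one hc]
  ring

theorem realGaussTerm_telescope {c : ℝ} (hc : 0 < c) (a b : ℝ) (n : ℕ) :
    ((c - a - b) * n - a * b) * realGaussTerm a b c n =
      (c + n) * (n * realGaussTerm a b c n -
        ((n + 1 : ℕ) : ℝ) * realGaussTerm a b c (n + 1)) := by
  have h := gaussTerm_telescope (c := (c : ℂ)) (by simpa using hc) a b n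
  have h1 := gaussTerm_add_one (c := (c : ℂ)) (by simpa using hc) a b n
  have : (((c - a - b) * n - a * b : ℝ) : ℂ) * gaussTerm a b c n =
      ((c : ℂ) + n) * (n * gaussTerm a b c n - ((n + 1 : ℕ) : ℂ) * gaussTerm a b c (n + 1)) := by
    rw [← h, h1]
    push_cast
    ring
  rw [← ofReal_realGaussTerm, ← ofReal_realGaussTerm] at this
  exact_mod_cast this

/-- A Raabe-type argument: from some index on, each term is at most `2 / d` times a difference of
consecutive values of `n * realGaussTerm a b c n`, so the partial sums are bounded by telescoping.
-/
theorem summable_realGaussTerm {a b c : ℝ} (ha : 0 ≤ a) (hb : 0 ≤ b) (hc : a + b < c) :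
    Summable (realGaussTerm a b c) := by
  have hc0 : 0 < c := by linarith
  set d := c - a - b with hd
  have hd0 : 0 < d := by linarith
  -- This `N` ensures `d n - a b ≥ (d / 2) (c + n)` for all `n ≥ N`.
  obtain ⟨N, hN⟩ := exists_nat_ge ((2 * (a * b) + d * c) / d)
  rw [← summable_nat_add_iff N]
  refine summable_of_sum_range_le (c := 2 / d * (N * realGaussTerm a b c N))
    (fun n => realGaussTerm_nonneg ha hb hc0 _) fun M => ?_
  have key : ∀ n : ℕ, N ≤ n → realGaussTerm a b c n ≤ 2 / d * (n * realGaussTerm a b c n -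
      ((n + 1 : ℕ) : ℝ) * realGaussTerm a b c (n + 1)) := by
    intro n hn
    have h := realGaussTerm_telescope hc0 a b n
    have hT := realGaussTerm_nonneg ha hb hc0 n
    have hn' : (N : ℝ) ≤ n := by exact_mod_cast hn
    rw [div_le_iff₀ hd0] at hN
    have hcn : 0 < c + n := by positivity
    set T := realGaussTerm a b c n
    set D := n * T - ((n + 1 : ℕ) : ℝ) * realGaussTerm a b c (n + 1)
    have h2 : d / 2 * (c + n) * T ≤ (c + n) * D := by
      rw [← h]
      refine mul_le_mul_of_nonneg_right ?_ hT
      nlinarith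
    have h3 : d / 2 * T ≤ D := by
      have : (c + n) * (d / 2 * T) ≤ (c + n) * D := by linarith
      exact le_of_mul_le_mul_left this hcn
    rw [div_mul_eq_mul_div, le_div_iff₀ hd0]
    linarith
  calc ∑ i ∈ Finset.range M, realGaussTerm a b c (i + N)
      ≤ ∑ i ∈ Finset.range M, (2 / d * (((i + N : ℕ) : ℝ) * realGaussTerm a b c (i + N)) -
        2 / d * (((i + 1 + N : ℕ) : ℝ) * realGaussTerm a b c (i + 1 + N))) := by
        refine Finset.sum_le_sum fun i _ => (key (i + N) (by omega)).trans (le_of_eq ?_)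
        rw [show i + 1 + N = i + N + 1 by ring]
        ring
    _ = 2 / d * (((0 + N : ℕ) : ℝ) * realGaussTerm a b c (0 + N)) -
        2 / d * (((M + N : ℕ) : ℝ) * realGaussTerm a b c (M + N)) :=
        Finset.sum_range_sub' (fun i => 2 / d * (((i + N : ℕ) : ℝ) * realGaussTerm a b c (i + N))) M
    _ ≤ _ := by
        have := realGaussTerm_nonneg ha hb hc0 (M + N)
        simp only [zero_add]
        have : 0 ≤ 2 / d * (((M + N : ℕ) : ℝ) * realGaussTerm a b c (M + N)) := by positivity
        linarith

/-- The constant is independent of `n` because `|(c)_n| ≥ (re c)_n`; this is how series with complex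
parameters are dominated by series with real ones. -/
theorem norm_inv_Gamma_add_nat_le {c : ℂ} (hc : 0 < c.re) (n : ℕ) :
    ‖(Complex.Gamma (c + n))⁻¹‖ ≤
      Real.Gamma c.re / ‖Complex.Gamma c‖ * (Real.Gamma (c.re + n))⁻¹ := by
  have h1 : 0 < ‖Complex.Gamma c‖ := norm_pos_iff.2 (Complex.Gamma_ne_zero_of_re_pos hc)
  have h2 := Real.Gamma_pos_of_pos hc
  have h3 := poch_pos hc n
  rw [Gamma_add_nat hc, realGamma_add_nat hc, norm_inv, norm_mul]
  calc (‖poch c n‖ * ‖Complex.Gamma c‖)⁻¹ ≤ (poch c.re n * ‖Complex.Gamma c‖)⁻¹ := by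
        gcongr
        exact poch_re_le_norm hc n
    _ = _ := by field_simp

theorem norm_gaussTerm_le {a b c : ℂ} {r r' : ℝ} (ha : ‖a‖ ≤ r) (hb : ‖b‖ ≤ r') (hc : 0 < c.re)
    (n : ℕ) : ‖gaussTerm a b c n‖ ≤
      Real.Gamma c.re / ‖Complex.Gamma c‖ * realGaussTerm r r' c.re n := by
  have h := norm_inv_Gamma_add_nat_le hc n
  have hr := (norm_nonneg a).trans ha
  have hr' := (norm_nonneg b).trans hb
  calc ‖gaussTerm a b c n‖ = ‖poch a n‖ * ‖poch b n‖ / n.factorial *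
        ‖(Complex.Gamma (c + n))⁻¹‖ := by
        simp [gaussTerm]; field_simp
    _ ≤ poch r n * poch r' n / n.factorial *
        (Real.Gamma c.re / ‖Complex.Gamma c‖ * (Real.Gamma (c.re + n))⁻¹) := by
        have := norm_poch_le ha n
        have := norm_poch_le hb n
        have := poch_nonneg hr n
        have := poch_nonneg hr' n
        gcongr
    _ = _ := by unfold realGaussTerm; field_simp

theorem summable_gaussTerm {a b c : ℂ} (hc : ‖a‖ + ‖b‖ < c.re) : Summable (gaussTerm a b c) :=
  have h : 0 < c.re := by linarith [norm_nonneg a, norm_nonneg b]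
  .of_norm_bounded ((summable_realGaussTerm (norm_nonneg a) (norm_nonneg b) hc).mul_left _)
    (norm_gaussTerm_le le_rfl le_rfl h)

theorem tsum_gaussTerm_add_one {a b c : ℂ} (hc : ‖a‖ + ‖b‖ + 1 < c.re) :
    (c - a - b) * ∑' n, gaussTerm a b c n =
      (c - a) * (c - b) * ∑' n, gaussTerm a b (c + 1) n := by
  have ha := norm_nonneg a
  have hb := norm_nonneg b
  have hc0 : 0 < c.re := by linarith
  have hS := summable_gaussTerm (a := a) (b := b) (c := c) (by linarith)
  have hS1 := summable_gaussTerm (a := a) (b := b) (c := c + 1) (by simp; linarith)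
  have hS0 := summable_gaussTerm (a := a) (b := b) (c := c - 1) (by simp; linarith)
  -- The boundary term of the telescoping sum vanishes because it is dominated by the terms with `c
  -- - 1`; the extra `1` in the hypothesis makes that series summable.
  have hu : Tendsto (fun n : ℕ => (n : ℂ) * gaussTerm a b c n) atTop (𝓝 0) := by
    refine squeeze_zero_norm (fun n => ?_) (tendsto_zero_iff_norm_tendsto_zero.1
      hS0.tendsto_atTop_zero)
    rw [gaussTerm_add_one (c := c - 1) (by simp; linarith), sub_add_cancel, norm_mul, norm_mul]
    gcongr
    calc ‖(n : ℂ)‖ = n := by simp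
      _ ≤ (c - 1 + n).re := by simp; linarith
      _ ≤ _ := Complex.re_le_norm _
  have h1 : HasSum (fun n : ℕ => (n : ℂ) * gaussTerm a b c n -
      ((n + 1 : ℕ) : ℂ) * gaussTerm a b c (n + 1)) 0 := by
    have hs : Summable (fun n : ℕ => (n : ℂ) * gaussTerm a b c n -
        ((n + 1 : ℕ) : ℂ) * gaussTerm a b c (n + 1)) := by
      refine ((hS.mul_left (c - a - b)).sub (hS1.mul_left ((c - a) * (c - b)))).congr fun n => ?_
      exact gaussTerm_telescope hc0 a b n
    have ht := hs.hasSum.tendsto_sum_nat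
    simp only [Finset.sum_range_sub' (fun n : ℕ => (n : ℂ) * gaussTerm a b c n)] at ht
    have ht' := (hu.const_sub ((0 : ℕ) * gaussTerm a b c 0))
    have := tendsto_nhds_unique ht ht'
    rw [Nat.cast_zero, zero_mul, sub_zero] at this
    exact this ▸ hs.hasSum
  have h2 := ((hS.hasSum.mul_left (c - a - b)).sub (hS1.hasSum.mul_left ((c - a) * (c - b))))
  simp only [gaussTerm_telescope hc0 a b] at h2
  exact sub_eq_zero.1 (h2.unique h1)

/-- Euler's limit formula for `Γ`, divided by `Γ(z)`. It supplies the asymptotics of the Gamma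
quotient in Gauss's theorem as `c` moves to infinity. -/
theorem tendsto_cpow_mul_factorial_div_Gamma {z : ℂ} (hz : 0 < z.re) :
    Tendsto (fun N : ℕ => (N : ℂ) ^ z * N.factorial / Complex.Gamma (z + (N + 1 : ℕ)))
      atTop (𝓝 1) := by
  have hG := Complex.Gamma_ne_zero_of_re_pos hz
  have h := (Complex.GammaSeq_tendsto_Gamma z).div_const (Complex.Gamma z)
  rw [div_self hG] at h
  refine h.congr fun N => ?_
  have hp : ∏ j ∈ Finset.range (N + 1), (z + j) = poch z (N + 1) := by
    generalize N + 1 = M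
    induction M with
    | zero => simp
    | succ M ih => rw [Finset.prod_range_succ, ih, poch_succ]
  rw [Complex.GammaSeq, hp, Gamma_add_nat hz, div_div]

/-- After normalisation the term `n = 0` is `1`, and every other term carries `1 / (c + N)_n`, which
tends to `0`; the real series at `re c` dominates uniformly in `N`. -/
theorem tendsto_tsum_gaussTerm_mul_Gamma {a b c : ℂ} (hc : ‖a‖ + ‖b‖ < c.re) :
    Tendsto (fun N : ℕ => (∑' n, gaussTerm a b (c + N) n) * Complex.Gamma (c + N))
      atTop (𝓝 1) := by
  have hc0 : 0 < c.re := by linarith [norm_nonneg a, norm_nonneg b]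
  have hcN : ∀ N : ℕ, 0 < (c + N).re := fun N => by simp; positivity
  have hterm : ∀ N n : ℕ, gaussTerm a b (c + N) n * Complex.Gamma (c + N) =
      poch a n * poch b n / n.factorial * (poch (c + N) n)⁻¹ := by
    intro N n
    have h1 := Complex.Gamma_ne_zero_of_re_pos (hcN N)
    rw [gaussTerm, Gamma_add_nat (hcN N)]
    have := poch_ne_zero (hcN N) n
    field_simp
  simp only [← tsum_mul_right, hterm]
  have h1 : (1 : ℂ) = ∑' n : ℕ, if n = 0 then 1 else 0 := by simp
  rw [h1]
  refine tendsto_tsum_of_dominated_convergence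
    (bound := fun n => Real.Gamma c.re * realGaussTerm ‖a‖ ‖b‖ c.re n)
    ((summable_realGaussTerm (norm_nonneg a) (norm_nonneg b) hc).mul_left _) ?_ ?_
  · rintro (_ | n)
    · simp
    · simp only [Nat.add_eq_zero_iff, one_ne_zero, and_false, if_false]
      rw [← mul_zero (poch a (n + 1) * poch b (n + 1) / (n + 1).factorial)]
      refine Tendsto.const_mul _ ?_
      refine squeeze_zero_norm
        (a := fun N : ℕ => (((c.re + N) * 1))⁻¹ * (poch (c.re + 1) n)⁻¹) ?_ ?_
      · intro N
        have h2 := poch_add (c + N) 1 n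
        have h3 : poch (c + N) 1 = c + N := by simpa using poch_succ (c + N) 0
        rw [add_comm n 1, h2, h3, norm_inv, norm_mul, mul_one, ← mul_inv]
        have hc1 : 0 < c.re + 1 := by linarith
        have := poch_pos hc1 n
        have hN : (0:ℝ) ≤ N := by positivity
        gcongr
        · simpa using Complex.re_le_norm (c + N)
        · exact (poch_mono hc1.le (by simp) n).trans (poch_re_le_norm (by simp; positivity) n)
      · rw [← zero_mul (poch (c.re + 1) n)⁻¹]
        refine Tendsto.mul_const _ ?_
        simp only [mul_one]
        exact (tendsto_atTop_add_const_left _ _ tendsto_natCast_atTop_atTop).inv_tendsto_atTop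
  · refine Eventually.of_forall fun N n => ?_
    rw [norm_mul, norm_div, norm_mul, norm_inv]
    have hp := poch_pos hc0 n
    have h2 : poch c.re n ≤ ‖poch (c + N) n‖ :=
      (poch_mono hc0.le (by simp) n).trans (poch_re_le_norm (hcN N) n)
    calc ‖poch a n‖ * ‖poch b n‖ / ‖(n.factorial : ℂ)‖ * ‖poch (c + N) n‖⁻¹
        ≤ poch ‖a‖ n * poch ‖b‖ n / n.factorial * (poch c.re n)⁻¹ := by
          have := norm_poch_le (a := a) le_rfl n
          have := norm_poch_le (a := b) le_rfl n
          have := poch_nonneg (norm_nonneg a) n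
          have := poch_nonneg (norm_nonneg b) n
          simp only [Complex.norm_natCast]
          gcongr
      _ = _ := by
          have := (Real.Gamma_pos_of_pos hc0).ne'
          rw [realGaussTerm, realGamma_add_nat hc0]
          field_simp

/-- **Gauss's summation theorem**, for `re c` large. -/
theorem hasSum_gaussTerm {a b c : ℂ} (hc : ‖a‖ + ‖b‖ + 1 < c.re) :
    HasSum (gaussTerm a b c)
      (Complex.Gamma (c - a - b) / (Complex.Gamma (c - a) * Complex.Gamma (c - b))) := by
  have hb := norm_nonneg b
  have ha := norm_nonneg a
  have hare := (abs_le.1 (Complex.abs_re_le_norm a)).2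
  have hbre := (abs_le.1 (Complex.abs_re_le_norm b)).2
  have hs := (summable_gaussTerm (a := a) (b := b) (c := c) (by linarith)).hasSum
  have hp0 : ∀ N : ℕ, 0 < (c + N).re := fun N => by
    have : (0 : ℝ) ≤ N := by positivity
    simp; linarith
  have hpa : ∀ N : ℕ, 0 < (c - a + N).re := fun N => by
    have : (0 : ℝ) ≤ N := by positivity
    simp; linarith
  have hpb : ∀ N : ℕ, 0 < (c - b + N).re := fun N => by
    have : (0 : ℝ) ≤ N := by positivity
    simp; linarith
  have hpab : ∀ N : ℕ, 0 < (c - a - b + N).re := fun N => by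
    have : (0 : ℝ) ≤ N := by positivity
    simp; linarith
  -- The ratio of the series to its claimed value at `c + N`: constant in `N` by the recurrence, and
  -- tending to `1`.
  set H : ℕ → ℂ := fun N => (∑' n, gaussTerm a b (c + N) n) *
    (Complex.Gamma (c - a + N) * Complex.Gamma (c - b + N) / Complex.Gamma (c - a - b + N)) with hH
  have hH0 : ∀ N, H N = H 0 := by
    intro N
    induction N with
    | zero => rfl
    | succ N ih =>
      rw [← ih]
      have hne : ∀ z : ℂ, 0 < z.re → z ≠ 0 := fun z hz h => by simp [h] at hz
      have h1 := tsum_gaussTerm_add_one (a := a) (b := b) (c := c + N) (by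
        have : (0 : ℝ) ≤ N := by positivity
        simp; linarith)
      simp only [hH]
      push_cast
      simp only [← add_assoc]
      rw [Complex.Gamma_add_one _ (hne _ (hpa N)), Complex.Gamma_add_one _ (hne _ (hpb N)),
        Complex.Gamma_add_one _ (hne _ (hpab N))]
      have e1 := hne _ (hpab N)
      have e2 := Complex.Gamma_ne_zero_of_re_pos (hpab N)
      field_simp
      linear_combination (-Complex.Gamma (c - a + N) * Complex.Gamma (c - b + N)) * h1
  have hlim : Tendsto (fun N => H (N + 1)) atTop (𝓝 1) := by
    have t0 := tendsto_cpow_mul_factorial_div_Gamma (by simpa using hp0 0 : 0 < c.re)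
    have ta := tendsto_cpow_mul_factorial_div_Gamma (by simpa using hpa 0 : 0 < (c - a).re)
    have tb := tendsto_cpow_mul_factorial_div_Gamma (by simpa using hpb 0 : 0 < (c - b).re)
    have tab := tendsto_cpow_mul_factorial_div_Gamma (by simpa using hpab 0 : 0 < (c - a - b).re)
    have tS := (tendsto_add_atTop_iff_nat 1).2
      (tendsto_tsum_gaussTerm_mul_Gamma (a := a) (b := b) (c := c) (by linarith))
    have := (tS.mul (t0.mul tab)).div (ta.mul tb) (by simp)
    simp only [mul_one, div_one] at this
    refine this.congr' ?_
    filter_upwards [eventually_ne_atTop 0] with N hN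
    have hN' : (N : ℂ) ≠ 0 := by exact_mod_cast hN
    have e0 := Complex.Gamma_ne_zero_of_re_pos (hp0 (N + 1))
    have ea := Complex.Gamma_ne_zero_of_re_pos (hpa (N + 1))
    have eb := Complex.Gamma_ne_zero_of_re_pos (hpb (N + 1))
    have eab := Complex.Gamma_ne_zero_of_re_pos (hpab (N + 1))
    have ef : (N.factorial : ℂ) ≠ 0 := by exact_mod_cast N.factorial_ne_zero
    have hp : (N : ℂ) ^ c * (N : ℂ) ^ (c - a - b) = (N : ℂ) ^ (c - a) * (N : ℂ) ^ (c - b) := by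
      rw [← Complex.cpow_add _ _ hN', ← Complex.cpow_add _ _ hN']
      ring_nf
    have q1 : (N : ℂ) ^ (c - a) ≠ 0 := by simp [Complex.cpow_eq_zero_iff, hN']
    have q2 : (N : ℂ) ^ (c - b) ≠ 0 := by simp [Complex.cpow_eq_zero_iff, hN']
    simp only [hH, Pi.div_apply]
    field_simp
    linear_combination (∑' n, gaussTerm a b (c + (N + 1 : ℕ)) n) * hp
  have h1 : H 0 = 1 := by
    simp only [hH0] at hlim
    exact tendsto_nhds_unique tendsto_const_nhds hlim
  simp only [hH, Nat.cast_zero, add_zero] at h1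
  have ea := Complex.Gamma_ne_zero_of_re_pos (hpa 0)
  have eb := Complex.Gamma_ne_zero_of_re_pos (hpb 0)
  have eab := Complex.Gamma_ne_zero_of_re_pos (hpab 0)
  simp only [Nat.cast_zero, add_zero] at ea eb eab
  convert hs using 1
  field_simp at h1 ⊢
  exact h1.symm

theorem hasSum_realGaussTerm {a b c : ℝ} (ha : 0 ≤ a) (hb : 0 ≤ b) (hc : a + b + 1 < c) :
    HasSum (realGaussTerm a b c)
      (Real.Gamma (c - a - b) / (Real.Gamma (c - a) * Real.Gamma (c - b))) := by
  have h := hasSum_gaussTerm (a := a) (b := b) (c := c)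
    (by simpa [abs_of_nonneg ha, abs_of_nonneg hb] using hc)
  rw [show gaussTerm a b c = fun n => ((realGaussTerm a b c n : ℝ) : ℂ) from
    funext fun n => (ofReal_realGaussTerm a b c n).symm] at h
  simp only [← Complex.ofReal_sub, Complex.Gamma_ofReal] at h
  exact_mod_cast h

/-! ### A double series summed by Gauss's theorem twice. -/

/-- The terms of a double series that is summed by two applications of Gauss's theorem. -/
def doubleTerm (a b a' d g : ℂ) (q : ℕ × ℕ) : ℂ :=
  poch a q.1 * poch b q.1 / q.1.factorial * gaussTerm a' (d + q.1) (g + q.1) q.2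

/-- The double series with real parameters. -/
def realDoubleTerm (a b a' d g : ℝ) (q : ℕ × ℕ) : ℝ :=
  poch a q.1 * poch b q.1 / q.1.factorial * realGaussTerm a' (d + q.1) (g + q.1) q.2

/-- The parameters `d + m` and `g + m` shift together, so the inner Gauss sum depends on `m` only
through `1 / Γ(g - a' + m)`. The outer series is then again a Gauss series, with lower parameter `g
- a'`. -/
theorem summable_realDoubleTerm {a b a' d g : ℝ} (ha : 0 ≤ a) (hb : 0 ≤ b) (ha' : 0 ≤ a')
    (hd : 0 ≤ d) (hg : a + b + a' + d + 2 < g) : Summable (realDoubleTerm a b a' d g) := by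
  have hin : ∀ m : ℕ, HasSum (realGaussTerm a' (d + m) (g + m))
      (Real.Gamma (g - a' - d) / (Real.Gamma (g - a' + m) * Real.Gamma (g - d))) := by
    intro m
    have h := hasSum_realGaussTerm (a := a') (b := d + m) (c := g + m) ha' (by positivity)
      (by linarith)
    rwa [show g + m - a' - (d + m) = g - a' - d by ring, show g + m - a' = g - a' + m by ring,
      show g + (m : ℝ) - (d + m) = g - d by ring] at h
  have hnn : 0 ≤ realDoubleTerm a b a' d g := fun q => by
    have := poch_nonneg ha q.1
    have := poch_nonneg hb q.1
    have := realGaussTerm_nonneg (a := a') (b := d + q.1) (c := g + q.1) ha' (by positivity)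
      (by have : (0 : ℝ) ≤ q.1 := by positivity
          linarith) q.2
    simp only [Pi.zero_apply, realDoubleTerm]
    positivity
  have hrow : ∀ m : ℕ, HasSum (fun n => realDoubleTerm a b a' d g (m, n))
      (poch a m * poch b m / m.factorial *
        (Real.Gamma (g - a' - d) / (Real.Gamma (g - a' + m) * Real.Gamma (g - d)))) :=
    fun m => (hin m).mul_left _
  rw [summable_prod_of_nonneg hnn]
  refine ⟨fun m => (hrow m).summable, ?_⟩
  have hs := (summable_realGaussTerm ha hb (c := g - a') (by linarith)).mul_left
    (Real.Gamma (g - a' - d) / Real.Gamma (g - d))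
  refine hs.congr fun m => ?_
  rw [(hrow m).tsum_eq, realGaussTerm]
  ring

theorem realDoubleTerm_eq (a b a' d g : ℝ) (q : ℕ × ℕ) :
    realDoubleTerm a b a' d g q = poch a q.1 * poch b q.1 * poch a' q.2 * poch (d + q.1) q.2 /
      (q.1.factorial * q.2.factorial) * (Real.Gamma (g + (q.1 + q.2 : ℕ)))⁻¹ := by
  simp only [realDoubleTerm, realGaussTerm, Nat.cast_add, ← add_assoc]
  field_simp

theorem doubleTerm_eq (a b a' d g : ℂ) (q : ℕ × ℕ) :
    doubleTerm a b a' d g q = poch a q.1 * poch b q.1 * poch a' q.2 * poch (d + q.1) q.2 /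
      (q.1.factorial * q.2.factorial) * (Complex.Gamma (g + (q.1 + q.2 : ℕ)))⁻¹ := by
  simp only [doubleTerm, gaussTerm, Nat.cast_add, ← add_assoc]
  field_simp

theorem norm_double_poch_le (a b a' d : ℂ) (q : ℕ × ℕ) :
    ‖poch a q.1 * poch b q.1 * poch a' q.2 * poch (d + q.1) q.2 /
      (q.1.factorial * q.2.factorial)‖ ≤
    poch ‖a‖ q.1 * poch ‖b‖ q.1 * poch ‖a'‖ q.2 * poch (‖d‖ + q.1) q.2 /
      (q.1.factorial * q.2.factorial) := by
  have h1 := norm_poch_le (a := a) le_rfl q.1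
  have h2 := norm_poch_le (a := b) le_rfl q.1
  have h3 := norm_poch_le (a := a') le_rfl q.2
  have h4 : ‖poch (d + q.1) q.2‖ ≤ poch (‖d‖ + q.1) q.2 :=
    norm_poch_le ((norm_add_le _ _).trans (by simp)) q.2
  have := poch_nonneg (norm_nonneg a) q.1
  have := poch_nonneg (norm_nonneg b) q.1
  have := poch_nonneg (norm_nonneg a') q.2
  simp only [norm_div, norm_mul, Complex.norm_natCast]
  gcongr

theorem summable_doubleTerm {a b a' d g : ℂ} (hg : ‖a‖ + ‖b‖ + ‖a'‖ + ‖d‖ + 2 < g.re) :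
    Summable (doubleTerm a b a' d g) := by
  have hg0 : 0 < g.re := by
    linarith [norm_nonneg a, norm_nonneg b, norm_nonneg a', norm_nonneg d]
  refine .of_norm_bounded ((summable_realDoubleTerm (norm_nonneg a) (norm_nonneg b)
    (norm_nonneg a') (norm_nonneg d) hg).mul_left (Real.Gamma g.re / ‖Complex.Gamma g‖))
    fun q => ?_
  rw [doubleTerm_eq, realDoubleTerm_eq, norm_mul, mul_left_comm]
  exact mul_le_mul (norm_double_poch_le a b a' d q) (norm_inv_Gamma_add_nat_le hg0 _)
    (norm_nonneg _) ((norm_nonneg _).trans (norm_double_poch_le a b a' d q))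

theorem hasSum_doubleTerm {a b a' d g : ℂ} (hg : ‖a‖ + ‖b‖ + ‖a'‖ + ‖d‖ + 2 < g.re) :
    HasSum (doubleTerm a b a' d g)
      (Complex.Gamma (g - a' - d) * Complex.Gamma (g - a' - a - b) /
        (Complex.Gamma (g - d) * Complex.Gamma (g - a' - a) * Complex.Gamma (g - a' - b))) := by
  have ha := norm_nonneg a
  have hb := norm_nonneg b
  have ha' := norm_nonneg a'
  have hd := norm_nonneg d
  have hin : ∀ m : ℕ, HasSum (gaussTerm a' (d + m) (g + m))
      (Complex.Gamma (g - a' - d) / (Complex.Gamma (g - a' + m) * Complex.Gamma (g - d))) := by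
    intro m
    have hdm : ‖d + m‖ ≤ ‖d‖ + m := (norm_add_le _ _).trans (by simp)
    have h := hasSum_gaussTerm (a := a') (b := d + m) (c := g + m) (by simp; linarith)
    rwa [show g + m - a' - (d + m) = g - a' - d by ring, show g + m - a' = g - a' + m by ring,
      show g + (m : ℂ) - (d + m) = g - d by ring] at h
  have h := (summable_doubleTerm hg).hasSum
  have hout := h.prod_fiberwise fun m => (hin m).mul_left (poch a m * poch b m / m.factorial)
  have hare := (abs_le.1 (Complex.abs_re_le_norm a')).2
  have hgs := (hasSum_gaussTerm (a := a) (b := b) (c := g - a') (by simp; linarith)).mul_left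
    (Complex.Gamma (g - a' - d) / Complex.Gamma (g - d))
  have heq : (fun m : ℕ => poch a m * poch b m / m.factorial *
      (Complex.Gamma (g - a' - d) / (Complex.Gamma (g - a' + m) * Complex.Gamma (g - d)))) =
      fun m => Complex.Gamma (g - a' - d) / Complex.Gamma (g - d) * gaussTerm a b (g - a') m := by
    funext m
    simp only [gaussTerm]
    field_simp
  rw [heq] at hout
  rw [hout.unique hgs] at h
  convert h using 1
  field_simp

/-! ### The Gauss hypergeometric function and Pfaff's transformation. -/

/-- The coefficients of the Gauss hypergeometric series. -/
def hypCoeff (a b c : ℂ) (n : ℕ) : ℂ := poch a n * poch b n / (n.factorial * poch c n)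

theorem hyp_eq_tsum (a b c z : ℂ) : ₂F₁ a b c z = ∑' n, hypCoeff a b c n * z ^ n := by
  rw [ordinaryHypergeometric_eq_tsum]
  refine tsum_congr fun n => ?_
  simp only [hypCoeff, poch, smul_eq_mul]
  field_simp

theorem hypCoeff_eq {c : ℂ} (hc : 0 < c.re) (a b : ℂ) (n : ℕ) :
    hypCoeff a b c n = Complex.Gamma c * (a.regularizedGaussHGFunSeries b c).coeff n := by
  rw [Complex.coeff_regularizedGaussHGFunSeries, Gamma_add_nat hc, hypCoeff]
  have := Complex.Gamma_ne_zero_of_re_pos hc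
  have := poch_ne_zero hc n
  have : (n.factorial : ℂ) ≠ 0 := by exact_mod_cast n.factorial_ne_zero
  simp only [poch] at *
  field_simp

theorem summable_norm_hypCoeff {a b c z : ℂ} (hc : 0 < c.re) (hz : ‖z‖ < 1) :
    Summable fun n => ‖hypCoeff a b c n * z ^ n‖ := by
  have h := (a.regularizedGaussHGFunSeries b c).summable_norm_apply (x := z) (by
    refine Metric.eball_subset_eball (Complex.radius_regularizedGaussHGFunSeries_ge_one a b c) ?_
    rw [Metric.mem_eball, edist_zero_right]
    rwa [← ofReal_norm, ENNReal.ofReal_lt_one])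
  refine (h.mul_left ‖Complex.Gamma c‖).congr fun n => ?_
  rw [hypCoeff_eq hc, FormalMultilinearSeries.apply_eq_pow_smul_coeff]
  simp only [norm_mul, smul_eq_mul]
  ring

theorem hasSum_hyp {a b c z : ℂ} (hc : 0 < c.re) (hz : ‖z‖ < 1) :
    HasSum (fun n => hypCoeff a b c n * z ^ n) (₂F₁ a b c z) := by
  rw [hyp_eq_tsum]
  exact (summable_norm_hypCoeff hc hz).of_norm.hasSum

theorem differentiableOn_hyp {a b c : ℂ} (hc : 0 < c.re) :
    DifferentiableOn ℂ (₂F₁ a b c : ℂ → ℂ) (Metric.ball 0 1) := by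
  have hne := Complex.Gamma_ne_zero_of_re_pos hc
  have hpoles : ∀ k : ℕ, c ≠ -k := fun k h => by
    rw [h] at hc
    simp at hc
    have : (0 : ℝ) ≤ k := by positivity
    linarith
  have h1 := Complex.radius_regularizedGaussHGFunSeries_ge_one a b c
  have h2 := (a.regularizedGaussHGFunSeries b c).hasFPowerSeriesOnBall
    (lt_of_lt_of_le (by simp) h1)
  have h3 : DifferentiableOn ℂ (Complex.regularizedGaussHGFun a b c) (Metric.ball 0 1) := by
    refine h2.differentiableOn.mono fun z hz => ?_
    refine Metric.eball_subset_eball h1 ?_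
    rw [mem_ball_zero_iff] at hz
    rw [Metric.mem_eball, edist_zero_right]
    rwa [← ofReal_norm, ENNReal.ofReal_lt_one]
  refine (h3.const_mul (Complex.Gamma c)).congr fun z _ => ?_
  rw [← Complex.ordinaryHypergeometric_div_Gamma_eq hpoles]
  field_simp

theorem hasSum_poch_div_factorial {a z : ℂ} (hz : ‖z‖ < 1) :
    HasSum (fun n : ℕ => poch a n / n.factorial * z ^ n) ((1 - z) ^ (-a)) := by
  have h := (Complex.one_div_one_sub_cpow_hasFPowerSeriesOnBall_zero a).hasSum (y := z) (by
    rw [Metric.mem_eball, edist_zero_right]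
    rwa [← ofReal_norm, ENNReal.ofReal_lt_one])
  rw [zero_add, one_div, ← Complex.cpow_neg] at h
  refine h.congr_fun ?_
  intro n
  rw [FormalMultilinearSeries.ofScalars_apply_eq, Ring.choose_eq_smul,
    Polynomial.descPochhammer_smeval_eq_ascPochhammer, Polynomial.ascPochhammer_smeval_cast,
    Polynomial.ascPochhammer_smeval_eq_eval]
  rw [show a + n - 1 - n + 1 = a by ring]
  simp only [poch, smul_eq_mul]
  ring

/-- The Chu–Vandermonde identity. -/
theorem sum_antidiagonal_poch (b c : ℂ) (N : ℕ) :
    ∑ q ∈ Finset.HasAntidiagonal.antidiagonal N, (-1) ^ q.1 * (N.choose q.1 : ℂ) *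
      (poch (c - b) q.1 * poch (c + q.1) q.2) = poch b N := by
  have h := Ring.descPochhammer_smeval_add (r := b - c) (s := c + N - 1) N (Commute.all _ _)
  rw [show b - c + (c + N - 1) = b + N - 1 by ring,
    Polynomial.descPochhammer_smeval_eq_ascPochhammer, show b + N - 1 - N + 1 = b by ring,
    Polynomial.ascPochhammer_smeval_eq_eval] at h
  rw [poch, h]
  refine Finset.sum_congr rfl fun q hq => ?_
  have hq' : (q.1 : ℂ) + q.2 = N := by exact_mod_cast Finset.HasAntidiagonal.mem_antidiagonal.1 hq
  rw [Polynomial.descPochhammer_smeval_eq_ascPochhammer (c + N - 1),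
    Polynomial.ascPochhammer_smeval_eq_eval, show c + N - 1 - q.2 + 1 = c + q.1 by
      rw [← hq']; ring]
  have h2 := Polynomial.ascPochhammer_smeval_neg_eq_descPochhammer (b - c) q.1
  rw [Polynomial.ascPochhammer_smeval_eq_eval, neg_sub] at h2
  have h3 : (descPochhammer ℤ q.1).smeval (b - c) = (-1) ^ q.1 * poch (c - b) q.1 := by
    rw [poch, h2]
    rcases Nat.even_or_odd q.1 with he | ho
    · simp [he.neg_one_pow, Int.negOnePow_even (q.1 : ℤ) (by exact_mod_cast he)]
    · simp [ho.neg_one_pow, Int.negOnePow_odd (q.1 : ℤ) (by exact_mod_cast ho)]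
  rw [h3]
  simp only [poch]
  ring

/-- The left side collects the terms of degree `N` when `(1 - z) ^ (-a) ₂F₁(a, c - b; c; z / (z -
1))` is expanded in powers of `z`; Chu–Vandermonde evaluates it. -/
theorem pfaff_antidiagonal {c : ℂ} (hc : 0 < c.re) (a b z : ℂ) (N : ℕ) :
    ∑ q ∈ Finset.HasAntidiagonal.antidiagonal N, poch a (q.1 + q.2) * poch (c - b) q.1 /
      (poch c q.1 * q.1.factorial * q.2.factorial) * (-1) ^ q.1 * z ^ (q.1 + q.2) =
      hypCoeff a b c N * z ^ N := by
  rw [hypCoeff, ← sum_antidiagonal_poch b c N, Finset.mul_sum, Finset.sum_div, Finset.sum_mul]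
  refine Finset.sum_congr rfl fun q hq => ?_
  have hq' := Finset.HasAntidiagonal.mem_antidiagonal.1 hq
  rw [← hq', poch_add c, Nat.cast_add_choose]
  have h1 := poch_ne_zero hc q.1
  have h2 : poch (c + q.1) q.2 ≠ 0 := poch_ne_zero (by simp; positivity) q.2
  have : (q.1.factorial : ℂ) ≠ 0 := by exact_mod_cast q.1.factorial_ne_zero
  have : (q.2.factorial : ℂ) ≠ 0 := by exact_mod_cast q.2.factorial_ne_zero
  have : ((q.1 + q.2).factorial : ℂ) ≠ 0 := by exact_mod_cast (q.1 + q.2).factorial_ne_zero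
  field_simp

theorem exists_norm_poch_div_le {c : ℂ} (hc : 0 < c.re) (d : ℂ) :
    ∃ M : ℝ, 0 ≤ M ∧ ∀ n, ‖poch d n / poch c n‖ ≤ M ^ n := by
  refine ⟨max 1 (‖d‖ / c.re), by positivity, fun n => ?_⟩
  induction n with
  | zero => simp
  | succ n ih =>
    rw [poch_succ, poch_succ, mul_div_mul_comm, norm_mul, pow_succ]
    have hcn : 0 < c.re + n := by positivity
    refine mul_le_mul ih ?_ (norm_nonneg _) (by positivity)
    rw [norm_div]
    have h1 : ‖d + n‖ ≤ ‖d‖ + n := (norm_add_le _ _).trans (by simp)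
    have h2 : c.re + n ≤ ‖c + n‖ := by simpa using Complex.re_le_norm (c + n)
    rw [div_le_iff₀ (hcn.trans_le h2)]
    have h3 : ‖d‖ ≤ max 1 (‖d‖ / c.re) * c.re := by
      rw [← div_le_iff₀ hc]; exact le_max_right _ _
    have h4 : (n : ℝ) ≤ max 1 (‖d‖ / c.re) * n :=
      le_mul_of_one_le_left (by positivity) (le_max_left _ _)
    calc ‖d + n‖ ≤ max 1 (‖d‖ / c.re) * (c.re + n) := by rw [mul_add]; linarith
      _ ≤ _ := by gcongr

theorem pfaff_eventually {c : ℂ} (hc : 0 < c.re) (a b : ℂ) :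
    ∀ᶠ z : ℂ in 𝓝 0, ₂F₁ a b c z = (1 - z) ^ (-a) * ₂F₁ a (c - b) c (z / (z - 1)) := by
  obtain ⟨M, hM, hMn⟩ := exists_norm_poch_div_le hc (c - b)
  -- The bound `1 / 3` keeps `z / (z - 1)` in the unit disc. The bound `1 / (1 + M)` makes the
  -- majorant `g` summable, since by the binomial theorem its antidiagonal sums are `(‖a‖)_N / N! *
  -- ((1 + M) ‖z‖) ^ N`.
  have hδ : 0 < min (1 / 3) (1 / (1 + M)) := by positivity
  filter_upwards [Metric.ball_mem_nhds (0 : ℂ) hδ] with z hz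
  rw [mem_ball_zero_iff, lt_min_iff, lt_div_iff₀ (by positivity)] at hz
  obtain ⟨hz1, hz2⟩ := hz
  rw [lt_div_iff₀ (by positivity)] at hz2
  have hzlt : ‖z‖ < 1 := by linarith
  have h1z : 1 - z ≠ 0 := fun h => by
    rw [← sub_eq_zero.1 h] at hzlt
    simp at hzlt
  have hw : ‖z / (z - 1)‖ < 1 := by
    have : 1 - ‖z‖ ≤ ‖z - 1‖ := by
      rw [norm_sub_rev]; simpa using norm_sub_norm_le (1 : ℂ) z
    rw [norm_div, div_lt_one (by linarith)]
    linarith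
  set f : ℕ × ℕ → ℂ := fun q => poch a (q.1 + q.2) * poch (c - b) q.1 /
      (poch c q.1 * q.1.factorial * q.2.factorial) * (-1) ^ q.1 * z ^ (q.1 + q.2) with hf
  set g : ℕ × ℕ → ℝ := fun q => poch ‖a‖ (q.1 + q.2) / (q.1 + q.2).factorial *
    (((q.1 + q.2).choose q.1 : ℝ) * M ^ q.1) * ‖z‖ ^ (q.1 + q.2) with hg
  have hg0 : ∀ q, 0 ≤ g q := fun q => by
    have := poch_nonneg (norm_nonneg a) (q.1 + q.2)
    positivity
  have hgs : Summable g := by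
    rw [← Finset.HasAntidiagonal.sigmaAntidiagonalEquivProd.summable_iff,
      summable_sigma_of_nonneg (f := g ∘ Finset.HasAntidiagonal.sigmaAntidiagonalEquivProd)
        (fun x => hg0 _)]
    refine ⟨fun N => Summable.of_finite, ?_⟩
    have hs : Summable fun N : ℕ => poch ‖a‖ N / N.factorial * ((1 + M) * ‖z‖) ^ N := by
      have h := (hasSum_poch_div_factorial (a := (‖a‖ : ℝ)) (z := ((1 + M) * ‖z‖ : ℝ)) (by
        rw [Complex.norm_real, Real.norm_of_nonneg (by positivity)]
        linarith)).summable
      simp only [← ofReal_poch] at h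
      exact_mod_cast h
    refine hs.congr fun N => ?_
    simp only [tsum_fintype, Function.comp_apply,
      Finset.HasAntidiagonal.sigmaAntidiagonalEquivProd_apply]
    rw [Finset.univ_eq_attach, Finset.sum_attach _ (fun q => g q), mul_pow, add_comm 1 M,
      (Commute.all M 1).add_pow', Finset.sum_mul, Finset.mul_sum]
    refine Finset.sum_congr rfl fun q hq => ?_
    rw [hg]
    simp only [Finset.HasAntidiagonal.mem_antidiagonal.1 hq, one_pow, mul_one, nsmul_eq_mul]
    ring
  have hfs : Summable f := by
    refine .of_norm_bounded hgs fun q => ?_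
    have h1 := norm_poch_le (a := a) le_rfl (q.1 + q.2)
    have h0 := poch_nonneg (norm_nonneg a) (q.1 + q.2)
    have h2 := hMn q.1
    have h3 : ‖f q‖ = ‖poch a (q.1 + q.2)‖ / (q.1.factorial * q.2.factorial) *
        ‖poch (c - b) q.1 / poch c q.1‖ * ‖z‖ ^ (q.1 + q.2) := by
      simp only [hf, norm_mul, norm_div, norm_pow, norm_neg, norm_one, one_pow, mul_one,
        Complex.norm_natCast]
      field_simp
    have h4 : g q = poch ‖a‖ (q.1 + q.2) / (q.1.factorial * q.2.factorial) *
        M ^ q.1 * ‖z‖ ^ (q.1 + q.2) := by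
      have : (q.1.factorial : ℝ) ≠ 0 := by exact_mod_cast q.1.factorial_ne_zero
      have : (q.2.factorial : ℝ) ≠ 0 := by exact_mod_cast q.2.factorial_ne_zero
      have : ((q.1 + q.2).factorial : ℝ) ≠ 0 := by exact_mod_cast (q.1 + q.2).factorial_ne_zero
      simp only [hg]
      rw [Nat.cast_add_choose]
      field_simp
    rw [h3, h4]
    gcongr
  -- The same double series is summed along antidiagonals here and along rows in `hrow`, where each
  -- row is a binomial series.
  have hL : HasSum f (₂F₁ a b c z) := by
    have h1 := (Finset.HasAntidiagonal.sigmaAntidiagonalEquivProd.hasSum_iff.2 hfs.hasSum).sigma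
      (fun N => (hasSum_fintype _))
    have h2 : HasSum (fun N => hypCoeff a b c N * z ^ N) (∑' q, f q) := by
      refine h1.congr_fun ?_
      intro N
      rw [← pfaff_antidiagonal hc]
      simp only [Function.comp_apply, Finset.HasAntidiagonal.sigmaAntidiagonalEquivProd_apply]
      rw [Finset.univ_eq_attach, Finset.sum_attach _ (fun q => f q)]
    rw [← h2.unique (hasSum_hyp hc hzlt)]
    exact hfs.hasSum
  have hrow : ∀ n : ℕ, HasSum (fun j => f (n, j))
      ((1 - z) ^ (-a) * (hypCoeff a (c - b) c n * (z / (z - 1)) ^ n)) := by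
    intro n
    have h := (hasSum_poch_div_factorial (a := a + n) hzlt).mul_left
      (hypCoeff a (c - b) c n * (-z) ^ n)
    have h1 : (fun j => f (n, j)) = fun j : ℕ => hypCoeff a (c - b) c n * (-z) ^ n *
        (poch (a + n) j / j.factorial * z ^ j) := by
      funext j
      simp only [hf, hypCoeff, poch_add a n j, neg_pow z, pow_add]
      field_simp
    have h2 : (1 - z) ^ (-a) * (hypCoeff a (c - b) c n * (z / (z - 1)) ^ n) =
        hypCoeff a (c - b) c n * (-z) ^ n * (1 - z) ^ (-(a + n)) := by
      rw [neg_add, Complex.cpow_add _ _ h1z, Complex.cpow_neg _ (n : ℂ), Complex.cpow_natCast,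
        ← neg_sub 1 z, div_neg, ← neg_div, div_pow]
      ring
    rw [h1, h2]
    exact h
  exact (hL.prod_fiberwise hrow).unique ((hasSum_hyp hc hw).mul_left _)

/-- **Pfaff's transformation** of the Gauss hypergeometric function. -/
theorem pfaff {c : ℂ} (hc : 0 < c.re) (a b : ℂ) {z : ℂ} (hz : ‖z‖ < 1) (hz' : z.re < 1 / 2) :
    ₂F₁ a b c z = (1 - z) ^ (-a) * ₂F₁ a (c - b) c (z / (z - 1)) := by
  -- For `re w < 1 / 2` one has `|w| < |w - 1|`, so both sides are holomorphic on this convex set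
  -- and the identity theorem spreads the equality from `0`.
  set U : Set ℂ := Metric.ball 0 1 ∩ {w : ℂ | w.re < 1 / 2} with hU
  have hUo : IsOpen U := Metric.isOpen_ball.inter (isOpen_lt Complex.continuous_re continuous_const)
  have hUc : Convex ℝ U := (convex_ball _ _).inter (convex_halfSpace_re_lt _)
  have hne : ∀ w ∈ U, w - 1 ≠ 0 := fun w hw h => by
    have h1 : w.re < 1 / 2 := hw.2
    rw [sub_eq_zero.1 h] at h1
    norm_num at h1
  have hmaps : MapsTo (fun w : ℂ => w / (w - 1)) U (Metric.ball 0 1) := by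
    intro w hw
    have h1 : w.re < 1 / 2 := hw.2
    rw [mem_ball_zero_iff, norm_div, div_lt_one (norm_pos_iff.2 (hne w hw)),
      ← sq_lt_sq₀ (norm_nonneg _) (norm_nonneg _), ← Complex.normSq_eq_norm_sq,
      ← Complex.normSq_eq_norm_sq, Complex.normSq_apply, Complex.normSq_apply]
    simp
    nlinarith
  have hL : DifferentiableOn ℂ (₂F₁ a b c : ℂ → ℂ) U :=
    (differentiableOn_hyp hc).mono inter_subset_left
  have hR : DifferentiableOn ℂ
      (fun w : ℂ => (1 - w) ^ (-a) * ₂F₁ a (c - b) c (w / (w - 1))) U := by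
    refine DifferentiableOn.mul ?_ ?_
    · intro w hw
      have h1 : w.re < 1 / 2 := hw.2
      refine (DifferentiableAt.cpow_const (by fun_prop) ?_).differentiableWithinAt
      left
      simp
      linarith
    · refine (differentiableOn_hyp hc).comp (fun w hw => ?_) hmaps
      have h1 := hne w hw
      have h2 : DifferentiableAt ℂ (fun w : ℂ => w / (w - 1)) w := by
        fun_prop (disch := assumption)
      exact h2.differentiableWithinAt
  have h0 : (0 : ℂ) ∈ U := by simp [hU]
  exact (hL.analyticOnNhd hUo).eqOn_of_preconnected_of_eventuallyEq (hR.analyticOnNhd hUo)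
    hUc.isPreconnected h0 (pfaff_eventually hc a b) ⟨by simpa using hz, hz'⟩

/-! ### Expansion of Appell's function in powers of `1 - 1 / u`. -/

/-- Pfaff's transformation makes the two branches of `gaussF` agree here, so one formula serves all
`u > 1`. -/
theorem gaussF_eq_of_one_lt {c : ℂ} (hc : 0 < c.re) (a b : ℂ) {u : ℝ} (hu : 1 < u) :
    gaussF a b c ((1 - u : ℝ) : ℂ) =
      (u : ℂ) ^ (-a) * ₂F₁ a (c - b) c ((1 - 1 / u : ℝ) : ℂ) := by
  have hu0 : (u : ℂ) ≠ 0 := by exact_mod_cast (by linarith : u ≠ 0)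
  have h1 : (1 : ℂ) - ((1 - u : ℝ) : ℂ) = u := by push_cast; ring
  have h2 : ((1 - u : ℝ) : ℂ) / (((1 - u : ℝ) : ℂ) - 1) = ((1 - 1 / u : ℝ) : ℂ) := by
    push_cast
    rw [show (1 : ℂ) - u - 1 = -u by ring]
    field_simp
    ring
  rw [gaussF]
  split_ifs with h
  · rw [pfaff hc a b h (by rw [Complex.ofReal_re]; linarith), h1, h2]
  · rw [h1, h2]

/-- The coefficients of the expansion of Appell's function `F₃` in powers of `1 - 1 / u`. -/
def appellCoeff (a a' b d c : ℂ) (q : ℕ × ℕ) : ℂ :=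
  poch a q.1 * poch b q.1 * poch a' q.2 * poch (d + q.1) q.2 /
    (q.1.factorial * q.2.factorial) / poch c (q.1 + q.2)

theorem appellF3_eq {c : ℂ} (hc : 0 < c.re) (a a' b b' : ℂ) {u : ℝ} (hu : 1 < u) :
    appellF3 a a' b b' c ((1 - 1 / u : ℝ) : ℂ) ((1 - u : ℝ) : ℂ) =
      (u : ℂ) ^ (-a') * ∑' m : ℕ, ∑' n : ℕ,
        appellCoeff a a' b (c - b') c (m, n) * ((1 - 1 / u : ℝ) : ℂ) ^ (m + n) := by
  have key : ∀ m : ℕ, (ascPochhammer ℂ m).eval a * (ascPochhammer ℂ m).eval b /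
      ((ascPochhammer ℂ m).eval c * (m.factorial : ℂ)) * ((1 - 1 / u : ℝ) : ℂ) ^ m *
        gaussF a' b' (c + m) ((1 - u : ℝ) : ℂ) = (u : ℂ) ^ (-a') * ∑' n : ℕ,
        appellCoeff a a' b (c - b') c (m, n) * ((1 - 1 / u : ℝ) : ℂ) ^ (m + n) := by
    intro m
    have hcm : 0 < (c + m).re := by simp; positivity
    rw [gaussF_eq_of_one_lt hcm a' b' hu, hyp_eq_tsum]
    generalize (u : ℂ) ^ (-a') = W
    generalize ((1 - 1 / u : ℝ) : ℂ) = X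
    change poch a m * poch b m / (poch c m * m.factorial) * X ^ m * (W * _) = _
    rw [mul_left_comm, ← tsum_mul_left]
    congr 1
    refine tsum_congr fun n => ?_
    have h1 := poch_ne_zero hc m
    have h2 := poch_ne_zero hcm n
    simp only [appellCoeff, hypCoeff, poch_add c, pow_add,
      show c + (m : ℂ) - b' = c - b' + m by ring]
    field_simp
  rw [appellF3, ← tsum_mul_left]
  exact tsum_congr key

/-! ### Integration of series and Beta integrals over `(1, ∞)`. -/

theorem ae_summable_and_integrable_tsum {ι X : Type*} [Countable ι] {_ : MeasurableSpace X}
    {ν : Measure X} {F : ι → X → ℂ} (hF : ∀ i, Integrable (F i) ν)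
    (hs : Summable fun i => ∫ a, ‖F i a‖ ∂ν) :
    (∀ᵐ a ∂ν, Summable fun i => ‖F i a‖) ∧ Integrable (fun a => ∑' i, F i a) ν := by
  have h1 : ∑' i, ∫⁻ a, ‖F i a‖ₑ ∂ν ≠ ⊤ := by
    have : ∀ i, ∫⁻ a, ‖F i a‖ₑ ∂ν = ENNReal.ofReal (∫ a, ‖F i a‖ ∂ν) := fun i =>
      (ofReal_integral_norm_eq_lintegral_enorm (hF i)).symm
    simp only [this]
    exact hs.tsum_ofReal_ne_top
  have h2 : ∀ᵐ a ∂ν, Summable fun i => ‖F i a‖ :=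
    summable_norm_of_tsum_eLpNorm_ne_top le_rfl (fun i => (hF i).1)
      (by simpa only [eLpNorm_one_eq_lintegral_enorm] using h1)
  refine ⟨h2, ?_, ?_⟩
  · refine aestronglyMeasurable_of_tendsto_ae (u := (atTop : Filter (Finset ι)))
      (f := fun s a => ∑ i ∈ s, F i a)
      (fun s => s.aestronglyMeasurable_fun_sum fun i _ => (hF i).1) ?_
    filter_upwards [h2] with a ha
    exact ha.of_norm.hasSum
  · refine lt_of_le_of_lt (lintegral_mono_ae (g := fun a => ∑' i, ‖F i a‖ₑ) ?_) ?_
    · filter_upwards with a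
      exact enorm_tsum_le_tsum_enorm
    · rw [lintegral_tsum fun i => (hF i).1.enorm]
      exact h1.lt_top

/-- The integrand of the Beta integral over `(1, ∞)`. -/
def betaKernel (c e : ℂ) (u : ℝ) : ℂ := ((u - 1 : ℝ) : ℂ) ^ (c - 1) * (u : ℂ) ^ (-(c + e))

/-- The substitution `u = 1 / v`, Jacobian included, leads to Euler's Beta integral on `(0, 1)`. -/
theorem betaKernel_inv {v : ℝ} (hv : v ∈ Ioo (0 : ℝ) 1) (c e : ℂ) :
    |-(v ^ 2)⁻¹| • betaKernel c e v⁻¹ = (v : ℂ) ^ (e - 1) * (1 - (v : ℂ)) ^ (c - 1) := by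
  obtain ⟨hv0, hv1⟩ := hv
  have hvc : (v : ℂ) ≠ 0 := by exact_mod_cast hv0.ne'
  have h1 : v⁻¹ - 1 = (1 - v) * v⁻¹ := by field_simp
  have h2 : ((v⁻¹ : ℝ) : ℂ) = (v : ℂ)⁻¹ := by push_cast; rfl
  have harg : (v : ℂ).arg ≠ Real.pi := by
    rw [Complex.arg_ofReal_of_nonneg hv0.le]; exact Real.pi_pos.ne
  rw [betaKernel, h1, Complex.ofReal_mul, Complex.mul_cpow_ofReal_nonneg (by linarith)
    (by positivity), h2, Complex.inv_cpow _ _ harg, Complex.inv_cpow _ _ harg,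
    ← Complex.cpow_neg, ← Complex.cpow_neg, abs_neg, abs_of_nonneg (by positivity),
    Complex.real_smul]
  have h3 : (((v ^ 2)⁻¹ : ℝ) : ℂ) = (v : ℂ) ^ (-2 : ℂ) := by
    push_cast
    rw [Complex.cpow_neg]
    norm_cast
  rw [h3, show e - 1 = -2 + (-(c - 1)) + -(-(c + e)) by ring, Complex.cpow_add _ _ hvc,
    Complex.cpow_add _ _ hvc]
  push_cast
  ring

theorem image_inv_Ioo_zero_one : (fun v : ℝ => v⁻¹) '' Ioo 0 1 = Ioi 1 := by
  ext u
  constructor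
  · rintro ⟨v, ⟨h0, h1⟩, rfl⟩
    exact (one_lt_inv₀ h0).2 h1
  · intro hu
    have hu : 1 < u := hu
    exact ⟨u⁻¹, ⟨by positivity, inv_lt_one_of_one_lt₀ hu⟩, by simp⟩

theorem integrableOn_betaKernel {c e : ℂ} (hc : 0 < c.re) (he : 0 < e.re) :
    IntegrableOn (betaKernel c e) (Ioi 1) := by
  have hd : ∀ v ∈ Ioo (0 : ℝ) 1, HasDerivWithinAt (fun v : ℝ => v⁻¹) (-(v ^ 2)⁻¹) (Ioo 0 1) v :=
    fun v hv => (hasDerivAt_inv hv.1.ne').hasDerivWithinAt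
  rw [← image_inv_Ioo_zero_one, integrableOn_image_iff_integrableOn_abs_deriv_smul
    measurableSet_Ioo hd (inv_injective.injOn),
    integrableOn_congr_fun (fun v hv => betaKernel_inv hv c e) measurableSet_Ioo,
    ← integrableOn_Ioc_iff_integrableOn_Ioo,
    ← intervalIntegrable_iff_integrableOn_Ioc_of_le zero_le_one]
  exact Complex.betaIntegral_convergent he hc

theorem integral_betaKernel {c e : ℂ} (hc : 0 < c.re) (he : 0 < e.re) :
    ∫ u in Ioi 1, betaKernel c e u =
      Complex.Gamma c * Complex.Gamma e * (Complex.Gamma (c + e))⁻¹ := by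
  have hd : ∀ v ∈ Ioo (0 : ℝ) 1, HasDerivWithinAt (fun v : ℝ => v⁻¹) (-(v ^ 2)⁻¹) (Ioo 0 1) v :=
    fun v hv => (hasDerivAt_inv hv.1.ne').hasDerivWithinAt
  rw [← image_inv_Ioo_zero_one, integral_image_eq_integral_abs_deriv_smul
    measurableSet_Ioo hd (inv_injective.injOn),
    setIntegral_congr_fun measurableSet_Ioo (fun v hv => betaKernel_inv hv c e),
    ← integral_Ioc_eq_integral_Ioo, ← intervalIntegral.integral_of_le zero_le_one]
  have h := Complex.betaIntegral_eq_Gamma_mul_div e c he hc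
  rw [Complex.betaIntegral] at h
  rw [h, add_comm e c]
  ring

theorem norm_betaKernel (c e : ℂ) {u : ℝ} (hu : 1 < u) :
    ((‖betaKernel c e u‖ : ℝ) : ℂ) = betaKernel c.re e.re u := by
  have h1 : 0 < u - 1 := by linarith
  have h2 : 0 < u := by linarith
  rw [betaKernel, betaKernel, norm_mul, Complex.norm_cpow_eq_rpow_re_of_pos h1,
    Complex.norm_cpow_eq_rpow_re_of_pos h2]
  push_cast
  rw [Complex.ofReal_cpow h1.le, Complex.ofReal_cpow h2.le]
  push_cast
  simp

theorem integral_norm_betaKernel {c e : ℂ} (hc : 0 < c.re) (he : 0 < e.re) :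
    ∫ u in Ioi 1, ‖betaKernel c e u‖ =
      Real.Gamma c.re * Real.Gamma e.re * (Real.Gamma (c.re + e.re))⁻¹ := by
  have h := integral_betaKernel (c := (c.re : ℂ)) (e := (e.re : ℂ)) (by simpa) (by simpa)
  rw [← setIntegral_congr_fun measurableSet_Ioi (fun u hu => norm_betaKernel c e hu),
    integral_complex_ofReal, ← Complex.ofReal_add, Complex.Gamma_ofReal, Complex.Gamma_ofReal,
    Complex.Gamma_ofReal] at h
  exact_mod_cast h

/-! ### Moments of the kernel for large exponents. -/

/-- The kernel of the right-sided Marichev–Saigo–Maeda integral, in the variable `u = t / x`. -/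
def msmKernel (a a' b b' c : ℂ) (u : ℝ) : ℂ :=
  ((u - 1 : ℝ) : ℂ) ^ (c - 1) * (u : ℂ) ^ (-a) *
    appellF3 a a' b b' c ((1 - 1 / u : ℝ) : ℂ) ((1 - u : ℝ) : ℂ)

theorem betaKernel_add_nat (c e : ℂ) (N : ℕ) {u : ℝ} (hu : 1 < u) :
    betaKernel (c + N) e u = betaKernel c e u * ((1 - 1 / u : ℝ) : ℂ) ^ N := by
  have h1 : ((u - 1 : ℝ) : ℂ) ≠ 0 := by exact_mod_cast (by linarith : u - 1 ≠ 0)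
  have h2 : (u : ℂ) ≠ 0 := by exact_mod_cast (by linarith : u ≠ 0)
  have h3 : ((1 - 1 / u : ℝ) : ℂ) = ((u - 1 : ℝ) : ℂ) / u := by push_cast; field_simp
  rw [betaKernel, betaKernel, h3, show c + N - 1 = c - 1 + N by ring,
    show -(c + N + e) = -(c + e) - N by ring, Complex.cpow_add _ _ h1, Complex.cpow_sub _ _ h2,
    Complex.cpow_natCast, Complex.cpow_natCast, div_pow]
  field_simp

theorem msmKernel_mul_cpow {c : ℂ} (hc : 0 < c.re) (a a' b b' s : ℂ) {u : ℝ} (hu : 1 < u) :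
    msmKernel a a' b b' c u * (u : ℂ) ^ (-s) = ∑' m : ℕ, ∑' n : ℕ,
      appellCoeff a a' b (c - b') c (m, n) * betaKernel (c + (m + n : ℕ)) (s + a + a' - c) u := by
  have h2 : (u : ℂ) ≠ 0 := by exact_mod_cast (by linarith : u ≠ 0)
  have h3 : betaKernel c (s + a + a' - c) u = ((u - 1 : ℝ) : ℂ) ^ (c - 1) * (u : ℂ) ^ (-a) *
      (u : ℂ) ^ (-a') * (u : ℂ) ^ (-s) := by
    rw [betaKernel, show -(c + (s + a + a' - c)) = -a + -a' + -s by ring,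
      Complex.cpow_add _ _ h2, Complex.cpow_add _ _ h2]
    ring
  simp only [betaKernel_add_nat _ _ _ hu, ← mul_left_comm (betaKernel c (s + a + a' - c) u),
    tsum_mul_left]
  rw [msmKernel, appellF3_eq hc a a' b b' hu, h3]
  ring

/-- The Beta integral contributes `Γ(c + m + n)`, which cancels the `(c)_(m+n)` of `F₃`; what
remains is the double series summed above. -/
theorem appellCoeff_mul_Gamma {c : ℂ} (hc : 0 < c.re) (a a' b d g : ℂ) (q : ℕ × ℕ) :
    appellCoeff a a' b d c q * (Complex.Gamma (c + (q.1 + q.2 : ℕ)) *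
      (Complex.Gamma (g + (q.1 + q.2 : ℕ)))⁻¹) = Complex.Gamma c * doubleTerm a b a' d g q := by
  rw [appellCoeff, doubleTerm_eq, Gamma_add_nat hc]
  have := poch_ne_zero hc (q.1 + q.2)
  field_simp

theorem norm_appellCoeff_mul_Gamma_le {c : ℂ} (hc : 0 < c.re) (a a' b d : ℂ) {g : ℝ} (hg : 0 < g)
    (q : ℕ × ℕ) :
    ‖appellCoeff a a' b d c q‖ * (Real.Gamma (c.re + (q.1 + q.2 : ℕ)) *
      (Real.Gamma (g + (q.1 + q.2 : ℕ)))⁻¹) ≤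
      Real.Gamma c.re * realDoubleTerm ‖a‖ ‖b‖ ‖a'‖ ‖d‖ g q := by
  have h1 := norm_double_poch_le a b a' d q
  have h2 := poch_re_le_norm hc (q.1 + q.2)
  have h3 := poch_pos hc (q.1 + q.2)
  have h4 := Real.Gamma_pos_of_pos hc
  have h5 : 0 < Real.Gamma (g + (q.1 + q.2 : ℕ)) := Real.Gamma_pos_of_pos (by positivity)
  rw [appellCoeff, norm_div, realDoubleTerm_eq, realGamma_add_nat hc]
  have h0 := (norm_nonneg _).trans h1
  set R := poch ‖a‖ q.1 * poch ‖b‖ q.1 * poch ‖a'‖ q.2 * poch (‖d‖ + q.1) q.2 /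
      (q.1.factorial * q.2.factorial)
  calc _ ≤ R / poch c.re (q.1 + q.2) * (poch c.re (q.1 + q.2) * Real.Gamma c.re *
        (Real.Gamma (g + (q.1 + q.2 : ℕ)))⁻¹) := by gcongr
    _ = _ := by field_simp

/-- The lower bound on `re (s + a + a')` is crude: it makes the double series of norms converge, and
analytic continuation in `s` removes it afterwards. -/
theorem integrable_and_integral_msmKernel {a a' b b' c s : ℂ} (hc : 0 < c.re)
    (he : 0 < (s + a + a' - c).re)
    (hs : ‖a‖ + ‖b‖ + ‖a'‖ + ‖c - b'‖ + 2 < (s + a + a').re) :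
    IntegrableOn (fun u => msmKernel a a' b b' c u * (u : ℂ) ^ (-s)) (Ioi 1) ∧
      ∫ u in Ioi 1, msmKernel a a' b b' c u * (u : ℂ) ^ (-s) =
        Complex.Gamma c * Complex.Gamma (s + a + a' - c) *
          (Complex.Gamma (s + a + b' - c) * Complex.Gamma (s - b) /
            (Complex.Gamma (s + a + a' + b' - c) * Complex.Gamma s *
              Complex.Gamma (s + a - b))) := by
  set e := s + a + a' - c with hedef
  set F : ℕ × ℕ → ℝ → ℂ := fun q u =>
    appellCoeff a a' b (c - b') c q * betaKernel (c + (q.1 + q.2 : ℕ)) e u with hFdef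
  have hcN : ∀ q : ℕ × ℕ, 0 < (c + (q.1 + q.2 : ℕ)).re := fun q => by
    rw [Complex.add_re, Complex.natCast_re]; positivity
  have hF : ∀ q, IntegrableOn (F q) (Ioi 1) := fun q =>
    (integrableOn_betaKernel (hcN q) he).const_mul _
  have hg : c + e = s + a + a' := by rw [hedef]; ring
  have hg0 : 0 < (c + e).re := by rw [Complex.add_re]; positivity
  have hnorm : Summable fun q => ∫ u in Ioi 1, ‖F q u‖ := by
    have hs1 := (summable_realDoubleTerm (norm_nonneg a) (norm_nonneg b) (norm_nonneg a')
      (norm_nonneg (c - b')) (hg ▸ hs)).mul_left (Real.Gamma e.re * Real.Gamma c.re)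
    refine hs1.of_nonneg_of_le (fun q => integral_nonneg fun u => norm_nonneg _) fun q => ?_
    simp only [hFdef, norm_mul, integral_const_mul]
    rw [integral_norm_betaKernel (hcN q) he, Complex.add_re, Complex.natCast_re, mul_assoc]
    have h1 := norm_appellCoeff_mul_Gamma_le hc a a' b (c - b') hg0 q
    have h2 := (Real.Gamma_pos_of_pos he).le
    calc _ = Real.Gamma e.re * (‖appellCoeff a a' b (c - b') c q‖ *
          (Real.Gamma (c.re + (q.1 + q.2 : ℕ)) *
            (Real.Gamma ((c + e).re + (q.1 + q.2 : ℕ)))⁻¹)) := by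
          rw [Complex.add_re c e, add_right_comm c.re]
          ring
      _ ≤ _ := by
          rw [mul_assoc]
          gcongr
  obtain ⟨hae, hint⟩ := ae_summable_and_integrable_tsum hF hnorm
  have hsum := hasSum_integral_of_summable_integral_norm hF hnorm
  -- Absolute summability at almost every `u` turns the sum over pairs into the iterated sum that
  -- represents `F₃`.
  have heq : ∀ᵐ u ∂(volume.restrict (Ioi (1 : ℝ))),
      ∑' q, F q u = msmKernel a a' b b' c u * (u : ℂ) ^ (-s) := by
    filter_upwards [hae, ae_restrict_mem measurableSet_Ioi] with u hu1 hu2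
    rw [hu1.of_norm.tsum_prod, msmKernel_mul_cpow hc a a' b b' s hu2]
  refine ⟨hint.congr heq, ?_⟩
  rw [integral_congr_ae heq] at hsum
  have hval := (hasSum_doubleTerm (a := a) (b := b) (a' := a') (d := c - b') (g := c + e)
    (hg ▸ hs)).mul_left (Complex.Gamma c * Complex.Gamma e)
  have hterm : (fun q => ∫ u in Ioi 1, F q u) = fun q =>
      Complex.Gamma c * Complex.Gamma e * doubleTerm a b a' (c - b') (c + e) q := by
    funext q
    simp only [hFdef, integral_const_mul]
    rw [integral_betaKernel (hcN q) he, add_right_comm, mul_right_comm (Complex.Gamma c),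
      ← appellCoeff_mul_Gamma hc]
    ring
  rw [hterm] at hsum
  rw [hsum.unique hval, hg]
  congr 3 <;> ring_nf

/-! ### Analytic continuation of the moments in the exponent. -/

theorem norm_ofReal_cpow_neg_le_one {u : ℝ} (hu : 1 < u) {w : ℂ} (hw : 0 ≤ w.re) :
    ‖(u : ℂ) ^ (-w)‖ ≤ 1 := by
  rw [Complex.norm_cpow_eq_rpow_re_of_pos (by linarith), Complex.neg_re]
  exact Real.rpow_le_one_of_one_le_of_nonpos hu.le (by linarith)

theorem measurable_ofReal_cpow_const (w : ℂ) : Measurable fun u : ℝ => (u : ℂ) ^ w := by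
  fun_prop

theorem cpow_neg_eq_mul {u : ℝ} (hu : 1 < u) (s s₀ : ℂ) :
    (u : ℂ) ^ (-s) = (u : ℂ) ^ (-s₀) * (u : ℂ) ^ (-(s - s₀)) := by
  rw [← Complex.cpow_add _ _ (by exact_mod_cast (by linarith : u ≠ 0))]
  ring_nf

theorem norm_mul_cpow_neg_le (K : ℝ → ℂ) {u : ℝ} (hu : 1 < u) {s s₀ : ℂ} (h : s₀.re ≤ s.re) :
    ‖K u * (u : ℂ) ^ (-s)‖ ≤ ‖K u * (u : ℂ) ^ (-s₀)‖ := by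
  rw [cpow_neg_eq_mul hu s s₀, ← mul_assoc, norm_mul _ ((u : ℂ) ^ (-(s - s₀)))]
  exact mul_le_of_le_one_right (norm_nonneg _) (norm_ofReal_cpow_neg_le_one hu (by simpa using h))

theorem integrableOn_mul_cpow_neg {K : ℝ → ℂ} {s s₀ : ℂ} (h : s₀.re ≤ s.re)
    (hK : IntegrableOn (fun u : ℝ => K u * (u : ℂ) ^ (-s₀)) (Ioi 1)) :
    IntegrableOn (fun u : ℝ => K u * (u : ℂ) ^ (-s)) (Ioi 1) := by
  refine Integrable.mono hK ?_ ?_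
  · have h1 := hK.1.mul (measurable_ofReal_cpow_const (-(s - s₀))).aestronglyMeasurable
    refine h1.congr ?_
    filter_upwards [ae_restrict_mem measurableSet_Ioi] with u hu
    rw [cpow_neg_eq_mul hu s s₀, ← mul_assoc]
    rfl
  · filter_upwards [ae_restrict_mem measurableSet_Ioi] with u hu
    exact norm_mul_cpow_neg_le K hu h

theorem differentiableOn_integral_cpow_neg {K : ℝ → ℂ} {s₀ : ℂ}
    (hK : IntegrableOn (fun u : ℝ => K u * (u : ℂ) ^ (-s₀)) (Ioi 1)) :
    DifferentiableOn ℂ (fun s : ℂ => ∫ u in Ioi (1 : ℝ), K u * (u : ℂ) ^ (-s))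
      {s : ℂ | s₀.re < s.re} := by
  intro s₁ hs₁
  have hs₁ : s₀.re < s₁.re := hs₁
  set δ := (s₁.re - s₀.re) / 2 with hδ
  have hδ0 : 0 < δ := by rw [hδ]; linarith
  have hre : ∀ s ∈ Metric.ball s₁ δ, s₀.re + δ ≤ s.re := by
    intro s hs
    have h1 : |(s - s₁).re| < δ := (Complex.abs_re_le_norm _).trans_lt (mem_ball_iff_norm.1 hs)
    rw [Complex.sub_re] at h1
    have := (abs_lt.1 h1).1
    rw [hδ] at this ⊢
    linarith
  have hi := fun (s : ℂ) (h : s₀.re ≤ s.re) => integrableOn_mul_cpow_neg h hK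
  refine (hasDerivAt_integral_of_dominated_loc_of_deriv_le
    (μ := volume.restrict (Ioi (1 : ℝ)))
    (F := fun (s : ℂ) (u : ℝ) => K u * (u : ℂ) ^ (-s))
    (F' := fun (s : ℂ) (u : ℝ) => K u * (u : ℂ) ^ (-s) * (-(Real.log u : ℂ)))
    (bound := fun u => ‖K u * (u : ℂ) ^ (-s₀)‖ * (1 / δ))
    (Metric.ball_mem_nhds s₁ hδ0) ?_ (hi s₁ hs₁.le) ?_ ?_ (hK.norm.mul_const _)
    ?_).2.differentiableAt.differentiableWithinAt
  · filter_upwards [Metric.ball_mem_nhds s₁ hδ0] with s hs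
    exact (hi s (by linarith [hre s hs])).1
  · exact (hi s₁ hs₁.le).1.mul (by fun_prop)
  · filter_upwards [ae_restrict_mem measurableSet_Ioi] with u hu s hs
    have hu1 : 1 < u := hu
    have h1 := norm_mul_cpow_neg_le K (s := s) (s₀ := s₀ + δ) hu1 (by simpa using hre s hs)
    have hlog := Real.log_nonneg hu1.le
    -- The factor `log u` created by differentiation is absorbed by the margin `u ^ (-δ)`.
    have h2 := Real.log_le_rpow_div (by linarith : 0 ≤ u) hδ0
    have h3 : ‖K u * (u : ℂ) ^ (-(s₀ + δ))‖ = ‖K u * (u : ℂ) ^ (-s₀)‖ * u ^ (-δ) := by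
      rw [cpow_neg_eq_mul hu1 (s₀ + δ) s₀, ← mul_assoc, norm_mul _ ((u : ℂ) ^ (-(s₀ + δ - s₀))),
        Complex.norm_cpow_eq_rpow_re_of_pos (by linarith)]
      simp
    rw [norm_mul, norm_neg, Complex.norm_real, Real.norm_of_nonneg hlog]
    have hpos : 0 < u ^ δ := Real.rpow_pos_of_pos (by linarith) δ
    calc _ ≤ ‖K u * (u : ℂ) ^ (-s₀)‖ * u ^ (-δ) * (u ^ δ / δ) := by
          rw [← h3]; gcongr
      _ = _ := by
          rw [Real.rpow_neg (by linarith)]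
          field_simp
  · filter_upwards [ae_restrict_mem measurableSet_Ioi] with u hu s _
    have hu0 : (0 : ℝ) < u := by linarith [show (1 : ℝ) < u from hu]
    have h1 := ((hasDerivAt_neg s).const_cpow (c := (u : ℂ))
      (Or.inl (by exact_mod_cast hu0.ne'))).const_mul (K u)
    rw [← Complex.ofReal_log hu0.le] at h1
    refine h1.congr_deriv ?_
    ring

/-- The point `s₀` may lie on the boundary of the half-plane of convergence, where holomorphy is not
available; the integrand at `s₀` itself dominates. -/
theorem tendsto_integral_cpow_neg {K : ℝ → ℂ} {s₀ : ℂ}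
    (hK : IntegrableOn (fun u : ℝ => K u * (u : ℂ) ^ (-s₀)) (Ioi 1)) :
    Tendsto (fun ε : ℝ => ∫ u in Ioi (1 : ℝ), K u * (u : ℂ) ^ (-(s₀ + ε))) (𝓝[>] 0)
      (𝓝 (∫ u in Ioi (1 : ℝ), K u * (u : ℂ) ^ (-s₀))) := by
  refine tendsto_integral_filter_of_dominated_convergence
    (fun u => ‖K u * (u : ℂ) ^ (-s₀)‖) ?_ ?_ hK.norm ?_
  · filter_upwards [self_mem_nhdsWithin] with ε hε
    have hε : 0 < ε := hε
    exact (integrableOn_mul_cpow_neg (by simpa using hε.le) hK).1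
  · filter_upwards [self_mem_nhdsWithin] with ε hε
    have hε : 0 < ε := hε
    filter_upwards [ae_restrict_mem measurableSet_Ioi] with u hu
    exact norm_mul_cpow_neg_le K hu (by simpa using hε.le)
  · filter_upwards [ae_restrict_mem measurableSet_Ioi] with u hu
    have hu0 : (u : ℂ) ≠ 0 := by
      exact_mod_cast (by linarith [show (1 : ℝ) < u from hu] : u ≠ 0)
    have h1 : Continuous fun ε : ℝ => K u * (u : ℂ) ^ (-(s₀ + ε)) := by
      refine continuous_const.mul (Continuous.const_cpow (by fun_prop) (Or.inl hu0))
    have := (h1.tendsto 0).mono_left (nhdsWithin_le_nhds (s := Ioi 0))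
    simpa using this

/-- The moments of the Marichev–Saigo–Maeda kernel, wherever they converge absolutely. -/
theorem integral_msmKernel_mul_inv_Gamma {a a' b b' c s₀ : ℂ} (hc : 0 < c.re)
    (hint : IntegrableOn (fun u => msmKernel a a' b b' c u * (u : ℂ) ^ (-s₀)) (Ioi 1)) :
    (∫ u in Ioi 1, msmKernel a a' b b' c u * (u : ℂ) ^ (-s₀)) *
        ((Complex.Gamma (s₀ - b))⁻¹ * (Complex.Gamma (s₀ + a + a' - c))⁻¹ *
          (Complex.Gamma (s₀ + a + b' - c))⁻¹) =
      Complex.Gamma c * ((Complex.Gamma s₀)⁻¹ * (Complex.Gamma (s₀ + a + a' + b' - c))⁻¹ *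
        (Complex.Gamma (s₀ + a - b))⁻¹) := by
  -- Reciprocal Gamma functions are entire, so in this form neither side has poles.
  set L : ℂ → ℂ := fun s => (∫ u in Ioi 1, msmKernel a a' b b' c u * (u : ℂ) ^ (-s)) *
        ((Complex.Gamma (s - b))⁻¹ * (Complex.Gamma (s + a + a' - c))⁻¹ *
          (Complex.Gamma (s + a + b' - c))⁻¹) with hL
  set R : ℂ → ℂ := fun s => Complex.Gamma c * ((Complex.Gamma s)⁻¹ *
    (Complex.Gamma (s + a + a' + b' - c))⁻¹ * (Complex.Gamma (s + a - b))⁻¹) with hR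
  change L s₀ = R s₀
  have hGamma : ∀ φ : ℂ → ℂ, Differentiable ℂ φ → Differentiable ℂ fun s =>
      (Complex.Gamma (φ s))⁻¹ := fun φ hφ => Complex.differentiable_one_div_Gamma.comp hφ
  have hM : Differentiable ℂ fun s : ℂ => ((Complex.Gamma (s - b))⁻¹ *
      (Complex.Gamma (s + a + a' - c))⁻¹ * (Complex.Gamma (s + a + b' - c))⁻¹) :=
    ((hGamma _ (by fun_prop)).mul (hGamma _ (by fun_prop))).mul (hGamma _ (by fun_prop))
  have hRd : Differentiable ℂ R :=
    (((hGamma _ (by fun_prop)).mul (hGamma _ (by fun_prop))).mul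
      (hGamma _ (by fun_prop))).const_mul _
  set U : Set ℂ := {s | s₀.re < s.re} with hU
  have hUo : IsOpen U := isOpen_lt continuous_const Complex.continuous_re
  have hLd : DifferentiableOn ℂ L U :=
    (differentiableOn_integral_cpow_neg hint).mul hM.differentiableOn
  set T : ℝ := |s₀.re| + ‖a‖ + ‖b‖ + ‖a'‖ + ‖b'‖ + ‖c‖ + ‖c - b'‖ + 2 + ‖a‖ + ‖a'‖ with hT
  have hlarge : ∀ s : ℂ, T < s.re → L s = R s := by
    intro s hs
    have ha := abs_le.1 (Complex.abs_re_le_norm a)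
    have ha' := abs_le.1 (Complex.abs_re_le_norm a')
    have hb := abs_le.1 (Complex.abs_re_le_norm b)
    have hb' := abs_le.1 (Complex.abs_re_le_norm b')
    have hc' := abs_le.1 (Complex.abs_re_le_norm c)
    have h0 := abs_nonneg s₀.re
    have h1 := norm_nonneg (c - b')
    have he : 0 < (s + a + a' - c).re := by
      simp only [Complex.add_re, Complex.sub_re]; linarith
    obtain ⟨-, h⟩ := integrable_and_integral_msmKernel (a := a) (a' := a') (b := b) (b' := b')
      hc he (by simp only [Complex.add_re]; linarith)
    have g1 := Complex.Gamma_ne_zero_of_re_pos he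
    have g2 : Complex.Gamma (s - b) ≠ 0 := Complex.Gamma_ne_zero_of_re_pos (by
      simp only [Complex.sub_re]; linarith)
    have g3 : Complex.Gamma (s + a + b' - c) ≠ 0 := Complex.Gamma_ne_zero_of_re_pos (by
      simp only [Complex.add_re, Complex.sub_re]; linarith)
    simp only [hL, hR, h]
    field_simp
  have hTU : s₀.re < T + 1 := by
    have := le_abs_self s₀.re
    have := norm_nonneg a
    have := norm_nonneg a'
    have := norm_nonneg b
    have := norm_nonneg b'
    have := norm_nonneg c
    have := norm_nonneg (c - b')
    rw [hT]; linarith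
  have hev : L =ᶠ[𝓝 ((T + 1 : ℝ) : ℂ)] R := by
    have hopen : IsOpen {s : ℂ | T < s.re} := isOpen_lt continuous_const Complex.continuous_re
    filter_upwards [hopen.mem_nhds (by rw [mem_ofPred_eq, Complex.ofReal_re]; linarith)] with s hs
    exact hlarge s hs
  have heq : EqOn L R U := (hLd.analyticOnNhd hUo).eqOn_of_preconnected_of_eventuallyEq
    (hRd.differentiableOn.analyticOnNhd hUo) (convex_halfSpace_re_gt _).isPreconnected
    (z₀ := ((T + 1 : ℝ) : ℂ)) (by rw [hU, mem_ofPred_eq, Complex.ofReal_re]; exact hTU) hev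
  have hpath : Tendsto (fun ε : ℝ => s₀ + (ε : ℂ)) (𝓝[>] 0) (𝓝 s₀) := by
    have : Continuous fun ε : ℝ => s₀ + (ε : ℂ) := by fun_prop
    simpa using (this.tendsto 0).mono_left (nhdsWithin_le_nhds (s := Ioi 0))
  have hLt : Tendsto (fun ε : ℝ => L (s₀ + ε)) (𝓝[>] 0) (𝓝 (L s₀)) :=
    (tendsto_integral_cpow_neg hint).mul ((hM.continuous.tendsto s₀).comp hpath)
  have hRt : Tendsto (fun ε : ℝ => R (s₀ + ε)) (𝓝[>] 0) (𝓝 (R s₀)) :=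
    (hRd.continuous.tendsto s₀).comp hpath
  refine tendsto_nhds_unique hLt (hRt.congr' ?_)
  filter_upwards [self_mem_nhdsWithin] with ε hε
  have hε : 0 < ε := hε
  exact (heq (by simpa [hU] using hε)).symm

/-! ### Termwise differentiation of series of complex powers. -/

/-- The power series with coefficients `E` converges absolutely everywhere. -/
def EntireCoeff (E : ℕ → ℂ) : Prop := ∀ r : ℝ, 0 ≤ r → Summable fun k => ‖E k‖ * r ^ k

theorem EntireCoeff.of_norm_le {E F : ℕ → ℂ} (hE : EntireCoeff E) {M : ℝ}
    (h : ∀ k, ‖F k‖ ≤ M * ‖E k‖) : EntireCoeff F := fun r hr =>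
  ((hE r hr).mul_left M).of_nonneg_of_le (fun k => by positivity) fun k => by
    rw [← mul_assoc]
    exact mul_le_mul_of_nonneg_right (h k) (by positivity)

/-- Linear growth in `k` is at most a constant times `2 ^ k`, which is absorbed by doubling the
radius. -/
theorem EntireCoeff.mul_linear {E : ℕ → ℂ} (hE : EntireCoeff E) (e : ℂ) :
    EntireCoeff fun k => E k * -(e + 2 * k) := by
  intro r hr
  refine ((hE (2 * r) (by positivity)).mul_left (‖e‖ + 2)).of_nonneg_of_le
    (fun k => by positivity) fun k => ?_
  have h1 : ‖-(e + 2 * k)‖ ≤ (‖e‖ + 2) * 2 ^ k := by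
    have h2 : (k : ℝ) ≤ 2 ^ k := by exact_mod_cast k.lt_two_pow_self.le
    have h3 : (1 : ℝ) ≤ 2 ^ k := one_le_pow₀ (by norm_num)
    rw [norm_neg]
    calc ‖e + 2 * k‖ ≤ ‖e‖ + 2 * k := (norm_add_le _ _).trans (by simp)
      _ ≤ ‖e‖ * 2 ^ k + 2 * 2 ^ k := by
          gcongr
          exact le_mul_of_one_le_right (norm_nonneg e) h3
      _ = _ := by ring
  rw [norm_mul, mul_pow]
  calc ‖E k‖ * ‖-(e + 2 * k)‖ * r ^ k ≤ ‖E k‖ * ((‖e‖ + 2) * 2 ^ k) * r ^ k := by gcongr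
    _ = _ := by ring

theorem norm_cpow_neg_add_two_mul {y : ℝ} (hy : 0 < y) (e : ℂ) (k : ℕ) :
    ‖(y : ℂ) ^ (-(e + 2 * k))‖ = y ^ (-e.re) * ((y ^ 2)⁻¹) ^ k := by
  rw [Complex.norm_cpow_eq_rpow_re_of_pos hy, inv_pow, ← pow_mul, ← Real.rpow_natCast,
    ← Real.rpow_neg hy.le, ← Real.rpow_add hy]
  congr 1
  simp
  ring

theorem EntireCoeff.summable_norm {E : ℕ → ℂ} (hE : EntireCoeff E) (e : ℂ) {y : ℝ} (hy : 0 < y) :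
    Summable fun k : ℕ => ‖E k * (y : ℂ) ^ (-(e + 2 * k))‖ := by
  refine ((hE ((y ^ 2)⁻¹) (by positivity)).mul_left (y ^ (-e.re))).congr fun k => ?_
  rw [norm_mul, norm_cpow_neg_add_two_mul hy]
  ring

theorem EntireCoeff.hasDerivAt {E : ℕ → ℂ} (hE : EntireCoeff E) (e : ℂ) {y : ℝ} (hy : 0 < y) :
    HasDerivAt (fun y : ℝ => ∑' k : ℕ, E k * (y : ℂ) ^ (-(e + 2 * k)))
      (∑' k : ℕ, (E k * -(e + 2 * k)) * (y : ℂ) ^ (-(e + 1 + 2 * k))) y := by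
  have hy2 : 0 < y / 2 := by positivity
  -- The sum of the two endpoint values bounds the power on `(y / 2, 2 y)` whatever the sign of the
  -- exponent.
  set M : ℝ := (y / 2) ^ (-(e + 1).re) + (2 * y) ^ (-(e + 1).re) with hM
  have hM0 : 0 ≤ M := by positivity
  refine hasDerivAt_tsum_of_isPreconnected (t := Ioo (y / 2) (2 * y)) (y₀ := y)
    (g := fun (k : ℕ) (y : ℝ) => E k * (y : ℂ) ^ (-(e + 2 * k)))
    (g' := fun (k : ℕ) (y : ℝ) => (E k * -(e + 2 * k)) * (y : ℂ) ^ (-(e + 1 + 2 * k)))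
    (((hE.mul_linear e) (((y / 2) ^ 2)⁻¹) (by positivity)).mul_left M) isOpen_Ioo
    isPreconnected_Ioo ?_ ?_ ⟨by linarith, by linarith⟩ (hE.summable_norm e hy).of_norm
    ⟨by linarith, by linarith⟩
  · intro k z hz
    have hz0 : 0 < z := hy2.trans hz.1
    -- A constant term is treated apart, since the power rule used below would divide by its
    -- exponent.
    by_cases h0 : e + 2 * k = 0
    · simp only [h0]
      simpa using hasDerivAt_const z (E k)
    · have h1 := (hasDerivAt_ofReal_cpow_const' (x := z) (r := -(e + 2 * k) - 1) hz0.ne'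
        (fun h => h0 (by linear_combination -h))).const_mul (E k * -(e + 2 * k))
      rw [show -(e + 1 + 2 * (k : ℂ)) = -(e + 2 * k) - 1 by ring]
      refine h1.congr_of_eventuallyEq (Eventually.of_forall fun w => ?_)
      simp only [sub_add_cancel]
      have : -(e + 2 * (k : ℂ)) ≠ 0 := neg_ne_zero.2 h0
      field_simp
  · intro k z hz
    have hz0 : 0 < z := hy2.trans hz.1
    rw [norm_mul, norm_cpow_neg_add_two_mul hz0]
    have h1 : z ^ (-(e + 1).re) ≤ M := by
      rcases le_total 0 (-(e + 1).re) with h | h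
      · have := Real.rpow_le_rpow hz0.le hz.2.le h
        have h3 : 0 ≤ (y / 2) ^ (-(e + 1).re) := by positivity
        linarith
      · have := Real.rpow_le_rpow_of_nonpos hy2 hz.1.le h
        have h3 : 0 ≤ (2 * y) ^ (-(e + 1).re) := by positivity
        linarith
    have h2 : (z ^ 2)⁻¹ ≤ ((y / 2) ^ 2)⁻¹ := by
      have := hz.1.le
      gcongr
    calc _ ≤ ‖E k * -(e + 2 * k)‖ * (M * (((y / 2) ^ 2)⁻¹) ^ k) := by gcongr
      _ = _ := by ring

theorem EntireCoeff.contDiffOn {E : ℕ → ℂ} (hE : EntireCoeff E) (e : ℂ) (n : ℕ) :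
    ContDiffOn ℝ n (fun y : ℝ => ∑' k : ℕ, E k * (y : ℂ) ^ (-(e + 2 * k))) (Ioi 0) := by
  induction n generalizing E e with
  | zero =>
    rw [Nat.cast_zero, contDiffOn_zero]
    exact fun y hy => (hE.hasDerivAt e hy).continuousAt.continuousWithinAt
  | succ n ih =>
    rw [Nat.cast_succ, contDiffOn_succ_iff_deriv_of_isOpen isOpen_Ioi]
    refine ⟨fun y hy => (hE.hasDerivAt e hy).differentiableAt.differentiableWithinAt,
      by simp, (ih (hE.mul_linear e) (e + 1)).congr fun y hy => (hE.hasDerivAt e hy).deriv⟩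

theorem EntireCoeff.mul_poch {E : ℕ → ℂ} (hE : EntireCoeff E) (e : ℂ) (n : ℕ) :
    EntireCoeff fun k => E k * ((-1) ^ n * poch (e + 2 * k) n) := by
  induction n with
  | zero => simpa using hE
  | succ n ih =>
    convert ih.mul_linear (e + n) using 2 with k
    rw [poch_succ]
    ring

theorem EntireCoeff.iteratedDeriv_eq {E : ℕ → ℂ} (hE : EntireCoeff E) (e : ℂ) (n : ℕ) {y : ℝ}
    (hy : 0 < y) :
    iteratedDeriv n (fun y : ℝ => ∑' k : ℕ, E k * (y : ℂ) ^ (-(e + 2 * k))) y =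
      ∑' k : ℕ, (E k * ((-1) ^ n * poch (e + 2 * k) n)) * (y : ℂ) ^ (-(e + n + 2 * k)) := by
  induction n generalizing y with
  | zero => simp
  | succ n ih =>
    rw [iteratedDeriv_succ]
    have h1 : iteratedDeriv n (fun y : ℝ => ∑' k : ℕ, E k * (y : ℂ) ^ (-(e + 2 * k))) =ᶠ[𝓝 y]
        fun y : ℝ => ∑' k : ℕ, (E k * ((-1) ^ n * poch (e + 2 * k) n)) *
          (y : ℂ) ^ (-(e + n + 2 * k)) := by
      filter_upwards [isOpen_Ioi.mem_nhds hy] with z hz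
      exact ih hz
    rw [h1.deriv_eq, ((hE.mul_poch e n).hasDerivAt (e + n) hy).deriv]
    refine tsum_congr fun k => ?_
    rw [poch_succ]
    push_cast
    ring_nf

/-! ### Decay of reciprocal Gamma values and the Struve coefficients. -/

/-- Up to the factor `Γ(α)` the quotient is a Beta integral over `(1, ∞)`, whose integrand tends to
`0` by dominated convergence. -/
theorem tendsto_Gamma_div_Gamma_add {α : ℝ} (hα : 0 < α) (μ : ℂ) :
    Tendsto (fun k : ℕ => Complex.Gamma (α * k + μ) * (Complex.Gamma (α * k + μ + α))⁻¹)
      atTop (𝓝 0) := by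
  have hlin : Tendsto (fun k : ℕ => α * (k : ℝ) + μ.re) atTop atTop :=
    tendsto_atTop_add_const_right _ _ (tendsto_natCast_atTop_atTop.const_mul_atTop hα)
  have hre : ∀ k : ℕ, ((α : ℂ) * k + μ).re = α * k + μ.re := fun k => by simp
  have hlim : Tendsto (fun k : ℕ => ∫ u in Ioi 1, betaKernel α (α * k + μ) u) atTop
      (𝓝 (∫ u in Ioi (1 : ℝ), (0 : ℂ))) := by
    refine tendsto_integral_filter_of_dominated_convergence
      (fun u => ‖betaKernel (α : ℂ) 1 u‖) ?_ ?_
      (integrableOn_betaKernel (by simpa) (by simp)).norm ?_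
    · filter_upwards [hlin.eventually_gt_atTop 0] with k hk
      exact (integrableOn_betaKernel (by simpa) (by rwa [hre])).1
    · filter_upwards [hlin.eventually_ge_atTop 1] with k hk
      filter_upwards [ae_restrict_mem measurableSet_Ioi] with u hu
      have hu1 : 1 < u := hu
      rw [betaKernel, betaKernel, norm_mul, norm_mul]
      refine mul_le_mul_of_nonneg_left ?_ (norm_nonneg _)
      rw [Complex.norm_cpow_eq_rpow_re_of_pos (by linarith),
        Complex.norm_cpow_eq_rpow_re_of_pos (by linarith)]
      refine Real.rpow_le_rpow_of_exponent_le hu1.le ?_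
      simp
      linarith
    · filter_upwards [ae_restrict_mem measurableSet_Ioi] with u hu
      have hu1 : 1 < u := hu
      have hu0 : 0 < u := by linarith
      rw [tendsto_zero_iff_norm_tendsto_zero]
      have h1 : ∀ k : ℕ, ‖betaKernel (α : ℂ) (α * k + μ) u‖ =
          ‖((u - 1 : ℝ) : ℂ) ^ ((α : ℂ) - 1)‖ * u ^ (-α) * u ^ (-(α * (k : ℝ) + μ.re)) := by
        intro k
        rw [betaKernel, norm_mul, Complex.norm_cpow_eq_rpow_re_of_pos hu0, mul_assoc,
          ← Real.rpow_add hu0]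
        congr 2
        simp
        ring
      simp only [h1]
      rw [← mul_zero (‖((u - 1 : ℝ) : ℂ) ^ ((α : ℂ) - 1)‖ * u ^ (-α))]
      refine Tendsto.const_mul _ ?_
      have h2 : Tendsto (fun x : ℝ => u ^ (-x)) atTop (𝓝 0) := by
        have := tendsto_rpow_atTop_of_base_lt_one u⁻¹ (by linarith [inv_pos.2 hu0])
          (inv_lt_one_of_one_lt₀ hu1)
        refine this.congr fun x => ?_
        rw [Real.inv_rpow hu0.le, Real.rpow_neg hu0.le]
      exact h2.comp hlin
  rw [integral_zero] at hlim
  have hG : Complex.Gamma α ≠ 0 := Complex.Gamma_ne_zero_of_re_pos (by simpa)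
  have h3 := hlim.const_mul (Complex.Gamma α)⁻¹
  rw [mul_zero] at h3
  refine h3.congr' ?_
  filter_upwards [hlin.eventually_gt_atTop 0] with k hk
  rw [integral_betaKernel (by simpa) (by rwa [hre]), add_comm ((α : ℂ) * k + μ)]
  field_simp

theorem entireCoeff_inv_Gamma {α : ℝ} (hα : 0 < α) (μ : ℂ) :
    EntireCoeff fun k : ℕ => (Complex.Gamma (α * k + μ))⁻¹ := by
  intro r hr
  have hlin : Tendsto (fun k : ℕ => α * (k : ℝ) + μ.re) atTop atTop :=
    tendsto_atTop_add_const_right _ _ (tendsto_natCast_atTop_atTop.const_mul_atTop hα)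
  have hne : ∀ᶠ k : ℕ in atTop, Complex.Gamma ((α : ℂ) * k + μ) ≠ 0 := by
    filter_upwards [hlin.eventually_gt_atTop 0] with k hk
    exact Complex.Gamma_ne_zero_of_re_pos (by simpa using hk)
  -- The radius `r + 1` in place of `r` keeps the terms nonzero for the ratio test when `r = 0`.
  have hs : Summable fun k : ℕ => (Complex.Gamma (α * k + μ))⁻¹ * ((r + 1 : ℝ) : ℂ) ^ k := by
    refine summable_of_ratio_test_tendsto_lt_one (l := 0) zero_lt_one ?_ ?_
    · filter_upwards [hne] with k hk
      refine mul_ne_zero (inv_ne_zero hk) (pow_ne_zero _ ?_)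
      exact_mod_cast (by linarith : r + 1 ≠ 0)
    · have h := ((tendsto_Gamma_div_Gamma_add hα μ).norm).const_mul (r + 1)
      rw [norm_zero, mul_zero] at h
      refine h.congr' ?_
      filter_upwards [hne] with k hk
      have h0 : 0 < r + 1 := by linarith
      have h2 : ‖Complex.Gamma ((α : ℂ) * k + μ)‖ ≠ 0 := norm_ne_zero_iff.2 hk
      rw [show (α : ℂ) * ((k + 1 : ℕ) : ℂ) + μ = α * k + μ + α by push_cast; ring]
      simp only [norm_mul, norm_inv, norm_pow, Complex.norm_real, Real.norm_of_nonneg h0.le,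
        pow_succ]
      field_simp
  refine hs.norm.of_nonneg_of_le (fun k => by positivity) fun k => ?_
  rw [norm_mul, norm_pow, Complex.norm_real, Real.norm_of_nonneg (by linarith)]
  gcongr
  linarith

theorem exists_norm_inv_Gamma_add_nat_le (ν : ℂ) :
    ∃ M : ℝ, ∀ n : ℕ, ‖(Complex.Gamma (ν + n))⁻¹‖ ≤ M := by
  have h := (entireCoeff_inv_Gamma one_pos ν) 1 zero_le_one
  obtain ⟨M, hM⟩ := h.tendsto_atTop_zero.bddAbove_range
  refine ⟨M, fun n => ?_⟩
  have := hM (mem_range_self n)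
  simpa [add_comm] using this

/-- The coefficients of the generalized Struve function. -/
def struveCoeff (a : ℕ) (c μ ν : ℂ) (α : ℝ) (k : ℕ) : ℂ :=
  (-c) ^ k / (Complex.Gamma ((α : ℂ) * k + μ) * Complex.Gamma ((a : ℂ) * k + ν))

theorem entireCoeff_struveCoeff (a : ℕ) (c μ ν : ℂ) {α : ℝ} (hα : 0 < α) :
    EntireCoeff (struveCoeff a c μ ν α) := by
  intro r hr
  obtain ⟨M, hM⟩ := exists_norm_inv_Gamma_add_nat_le ν
  refine (((entireCoeff_inv_Gamma hα μ) (‖c‖ * r) (by positivity)).mul_left M).of_nonneg_of_le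
    (fun k => by positivity) fun k => ?_
  -- Only boundedness of the second Gamma factor is needed, so `a = 0` is covered; the decay comes
  -- from `α > 0`.
  have h1 := hM (a * k)
  rw [Nat.cast_mul, add_comm] at h1
  rw [struveCoeff, div_eq_mul_inv, mul_inv, norm_mul, norm_mul, norm_pow, norm_neg, mul_pow]
  calc _ = ‖c‖ ^ k * ‖(Complex.Gamma (α * k + μ))⁻¹‖ * r ^ k *
        ‖(Complex.Gamma (a * k + ν))⁻¹‖ := by ring
    _ ≤ ‖c‖ ^ k * ‖(Complex.Gamma (α * k + μ))⁻¹‖ * r ^ k * M := by gcongr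
    _ = _ := by ring

/-! ### From convergence for the series to convergence for its leading power. -/

/-- Divided by its leading power, the series tends to `D k₀` as `t → ∞`, so its norm is eventually
at least `‖D k₀‖ / 2` times that of the power. -/
theorem exists_norm_leading_le {D : ℕ → ℂ} (hD : EntireCoeff D) (s : ℂ) {k₀ : ℕ} (h0 : D k₀ ≠ 0)
    (hlt : ∀ k < k₀, D k = 0) :
    ∃ M : ℝ, 0 ≤ M ∧ ∃ R : ℝ, ∀ t : ℝ, R ≤ t → 0 < t →
      ‖(t : ℂ) ^ (-(s + 2 * k₀))‖ ≤ M * ‖∑' k : ℕ, D k * (t : ℂ) ^ (-(s + 2 * k))‖ := by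
  have hfac : ∀ t : ℝ, 0 < t → ∑' k : ℕ, D k * (t : ℂ) ^ (-(s + 2 * k)) =
      (t : ℂ) ^ (-(s + 2 * k₀)) * ∑' j : ℕ, D (j + k₀) * (((t ^ 2)⁻¹ : ℝ) : ℂ) ^ j := by
    intro t ht
    have htc : (t : ℂ) ≠ 0 := by exact_mod_cast ht.ne'
    rw [← (hD.summable_norm s ht).of_norm.sum_add_tsum_nat_add k₀,
      Finset.sum_eq_zero fun k hk => by rw [hlt k (Finset.mem_range.1 hk), zero_mul], zero_add,
      ← tsum_mul_left]
    refine tsum_congr fun j => ?_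
    have h1 : (((t ^ 2)⁻¹ : ℝ) : ℂ) ^ j = (t : ℂ) ^ (-(2 * (j : ℂ))) := by
      rw [Complex.cpow_neg, Complex.cpow_mul_nat, Complex.ofReal_inv, inv_pow]
      norm_cast
    rw [h1, mul_left_comm, ← Complex.cpow_add _ _ htc]
    push_cast
    ring_nf
  have hlim : Tendsto (fun t : ℝ => ∑' j : ℕ, D (j + k₀) * (((t ^ 2)⁻¹ : ℝ) : ℂ) ^ j) atTop
      (𝓝 (∑' j : ℕ, if j = 0 then D k₀ else 0)) := by
    refine tendsto_tsum_of_dominated_convergence (bound := fun j => ‖D (j + k₀)‖) ?_ ?_ ?_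
    · have := hD 1 zero_le_one
      simp only [one_pow, mul_one] at this
      exact (summable_nat_add_iff k₀).2 this
    · rintro (_ | j)
      · simp
      · have h1 : Tendsto (fun t : ℝ => (((t ^ 2)⁻¹ : ℝ) : ℂ)) atTop (𝓝 0) := by
          have := (tendsto_pow_atTop (α := ℝ) two_ne_zero).inv_tendsto_atTop
          exact_mod_cast (Complex.continuous_ofReal.tendsto 0).comp this
        simpa using (h1.pow (j + 1)).const_mul (D (j + 1 + k₀))
    · filter_upwards [eventually_ge_atTop 1] with t ht j
      rw [norm_mul, norm_pow, Complex.norm_real, Real.norm_of_nonneg (by positivity)]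
      exact mul_le_of_le_one_right (norm_nonneg _)
        (pow_le_one₀ (by positivity) (inv_le_one_of_one_le₀ (one_le_pow₀ ht)))
  rw [tsum_ite_eq] at hlim
  have hpos : 0 < ‖D k₀‖ := norm_pos_iff.2 h0
  obtain ⟨R, hR⟩ := eventually_atTop.1 (hlim.norm.eventually_const_le (half_lt_self hpos))
  refine ⟨2 / ‖D k₀‖, by positivity, R, fun t ht ht0 => ?_⟩
  rw [hfac t ht0, norm_mul, mul_left_comm]
  refine le_mul_of_one_le_right (norm_nonneg _) ?_
  have h := hR t ht
  rw [div_mul_eq_mul_div, le_div_iff₀ hpos]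
  linarith

/-- Beyond `R` the function `f` dominates. On `(1, R]` the powers `u ^ (-s)` and `u ^ (-S)` are
comparable, so the known moment at `S` controls the kernel near `u = 1`. -/
theorem integrableOn_mul_cpow_of_le {K f : ℝ → ℂ} {s S : ℂ} {M R : ℝ}
    (hS : IntegrableOn (fun u : ℝ => K u * (u : ℂ) ^ (-S)) (Ioi 1)) (hR : 1 ≤ R) (hM : 0 ≤ M)
    (hle : ∀ u : ℝ, R ≤ u → ‖(u : ℂ) ^ (-s)‖ ≤ M * ‖f u‖)
    (hf : IntegrableOn (fun u => K u * f u) (Ioi 1)) :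
    IntegrableOn (fun u : ℝ => K u * (u : ℂ) ^ (-s)) (Ioi 1) := by
  refine Integrable.mono' ((hS.norm.const_mul (R ^ |(s - S).re|)).add (hf.norm.const_mul M)) ?_ ?_
  · have h1 := hS.1.mul (measurable_ofReal_cpow_const (-(s - S))).aestronglyMeasurable
    refine h1.congr ?_
    filter_upwards [ae_restrict_mem measurableSet_Ioi] with u hu
    rw [cpow_neg_eq_mul hu s S, ← mul_assoc]
    rfl
  · filter_upwards [ae_restrict_mem measurableSet_Ioi] with u hu
    have hu1 : 1 < u := hu
    have hu0 : 0 < u := by linarith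
    have hR0 : 0 ≤ R := by linarith
    simp only [Pi.add_apply]
    rcases le_total R u with h | h
    · rw [norm_mul, norm_mul (K u) (f u)]
      have h1 := mul_le_mul_of_nonneg_left (hle u h) (norm_nonneg (K u))
      have h2 : 0 ≤ R ^ |(s - S).re| * ‖K u * (u : ℂ) ^ (-S)‖ := by positivity
      linarith
    · have h1 : ‖(u : ℂ) ^ (-(s - S))‖ ≤ R ^ |(s - S).re| := by
        rw [Complex.norm_cpow_eq_rpow_re_of_pos hu0, Complex.neg_re]
        exact (Real.rpow_le_rpow_of_exponent_le hu1.le (neg_le_abs _)).trans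
          (Real.rpow_le_rpow hu0.le h (abs_nonneg _))
      rw [cpow_neg_eq_mul hu1 s S, ← mul_assoc, norm_mul _ ((u : ℂ) ^ (-(s - S))), mul_comm]
      have h2 := mul_le_mul_of_nonneg_right h1 (norm_nonneg (K u * (u : ℂ) ^ (-S)))
      have h3 : 0 ≤ M * ‖K u * f u‖ := by positivity
      linarith

/-! ### The fractional integral of a series of powers. -/

theorem rightMSMIntegrand_mul (a a' b b' c : ℂ) (f : ℝ → ℂ) {y u : ℝ} (hy : 0 < y) (hu : 1 < u) :
    rightMSMIntegrand a a' b b' c f y (y * u) =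
      (y : ℂ) ^ (c - 1) * (y : ℂ) ^ (-a) * (msmKernel a a' b b' c u * f (y * u)) := by
  have h1 : y * u - y = y * (u - 1) := by ring
  have h2 : y / (y * u) = 1 / u := by field_simp
  have h3 : y * u / y = u := by field_simp
  rw [rightMSMIntegrand, msmKernel, h1, h2, h3, Complex.ofReal_mul, Complex.ofReal_mul,
    Complex.mul_cpow_ofReal_nonneg hy.le (by linarith),
    Complex.mul_cpow_ofReal_nonneg hy.le (by linarith)]
  ring

theorem integrableOn_msmKernel_mul {a a' b b' c : ℂ} {f : ℝ → ℂ} {y : ℝ} (hy : 0 < y)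
    (h : IntegrableOn (rightMSMIntegrand a a' b b' c f y) (Ioi y)) :
    IntegrableOn (fun u => msmKernel a a' b b' c u * f (y * u)) (Ioi 1) := by
  have hyc : (y : ℂ) ≠ 0 := by exact_mod_cast hy.ne'
  rw [show Ioi y = Ioi (y * 1) by rw [mul_one], ← integrableOn_Ioi_comp_mul_left_iff _ _ hy,
    integrableOn_congr_fun (fun (u : ℝ) (hu : u ∈ Ioi (1 : ℝ)) =>
      rightMSMIntegrand_mul a a' b b' c f hy hu) measurableSet_Ioi] at h
  have h1 : (y : ℂ) ^ (c - 1) * (y : ℂ) ^ (-a) ≠ 0 := by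
    rw [← Complex.cpow_add _ _ hyc]
    simp [Complex.cpow_eq_zero_iff, hyc]
  refine (h.const_mul ((y : ℂ) ^ (c - 1) * (y : ℂ) ^ (-a))⁻¹).congr
    (Eventually.of_forall fun u => ?_)
  simp only
  rw [inv_mul_cancel_left₀ h1]

theorem rightMSMIntegral_eq (a a' b b' c : ℂ) (f : ℝ → ℂ) {y : ℝ} (hy : 0 < y) :
    rightMSMIntegral a a' b b' c f y = (y : ℂ) ^ (-a' + c - a) / Complex.Gamma c *
      ∫ u in Ioi 1, msmKernel a a' b b' c u * f (y * u) := by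
  have hyc : (y : ℂ) ≠ 0 := by exact_mod_cast hy.ne'
  have h := integral_comp_mul_left_Ioi' (rightMSMIntegrand a a' b b' c f y) 1 hy
  rw [mul_one] at h
  rw [rightMSMIntegral, ← h,
    setIntegral_congr_fun measurableSet_Ioi (fun u hu => rightMSMIntegrand_mul a a' b b' c f hy hu),
    integral_const_mul, Complex.real_smul,
    show -a' + c - a = -a' + 1 + (c - 1) + -a by ring, Complex.cpow_add _ _ hyc,
    Complex.cpow_add _ _ hyc, Complex.cpow_add _ _ hyc, Complex.cpow_one]
  ring

/-- A bound `J` uniform in `k` suffices for Fubini. Indices with `D k = 0` are exempt because their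
moments may diverge. -/
theorem integral_mul_tsum_cpow {K : ℝ → ℂ} {D : ℕ → ℂ} (hD : EntireCoeff D) {s : ℂ} {J : ℝ}
    (hint : ∀ k : ℕ, D k ≠ 0 → IntegrableOn (fun u : ℝ => K u * (u : ℂ) ^ (-(s + 2 * k))) (Ioi 1))
    (hJ : ∀ k : ℕ, D k ≠ 0 → ∫ u in Ioi (1 : ℝ), ‖K u * (u : ℂ) ^ (-(s + 2 * k))‖ ≤ J)
    {y : ℝ} (hy : 0 < y) :
    ∫ u in Ioi (1 : ℝ), K u * ∑' k : ℕ, D k * ((y * u : ℝ) : ℂ) ^ (-(s + 2 * k)) =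
      ∑' k : ℕ, D k * (y : ℂ) ^ (-(s + 2 * k)) *
        ∫ u in Ioi (1 : ℝ), K u * (u : ℂ) ^ (-(s + 2 * k)) := by
  set F : ℕ → ℝ → ℂ := fun k u =>
    D k * (y : ℂ) ^ (-(s + 2 * k)) * (K u * (u : ℂ) ^ (-(s + 2 * k))) with hF
  have hFint : ∀ k, IntegrableOn (F k) (Ioi 1) := by
    intro k
    by_cases h : D k = 0
    · simp [hF, h]
    · exact (hint k h).const_mul _
  have hsum : Summable fun k => ∫ u in Ioi (1 : ℝ), ‖F k u‖ := by
    refine ((hD.summable_norm s hy).mul_right J).of_nonneg_of_le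
      (fun k => integral_nonneg fun u => norm_nonneg _) fun k => ?_
    simp only [hF, norm_mul _ (K _ * _), integral_const_mul]
    by_cases h : D k = 0
    · simp [h]
    · exact mul_le_mul_of_nonneg_left (hJ k h) (norm_nonneg _)
  have h := (hasSum_integral_of_summable_integral_norm hFint hsum).tsum_eq
  simp only [hF, integral_const_mul] at h
  rw [h]
  refine setIntegral_congr_fun measurableSet_Ioi fun u hu => ?_
  have hu1 : 1 < u := hu
  rw [← tsum_mul_left]
  refine tsum_congr fun k => ?_
  rw [Complex.ofReal_mul, Complex.mul_cpow_ofReal_nonneg hy.le (by linarith)]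
  ring

/-- The Marichev–Saigo–Maeda integral of a series `∑ D k * t ^ (-(s + 2 k))`, under the sole
assumption that it converges absolutely at one point. -/
theorem rightMSMIntegral_tsum {a a' b b' c s : ℂ} (hc : 0 < c.re) {D : ℕ → ℂ}
    (hD : EntireCoeff D) {f : ℝ → ℂ}
    (hf : ∀ t : ℝ, 0 < t → f t = ∑' k : ℕ, D k * (t : ℂ) ^ (-(s + 2 * k))) {x : ℝ} (hx : 0 < x)
    (hint : IntegrableOn (rightMSMIntegrand a a' b b' c f x) (Ioi x)) :
    ∃ E : ℕ → ℂ, EntireCoeff E ∧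
      (∀ y : ℝ, 0 < y → rightMSMIntegral a a' b b' c f y =
        ∑' k : ℕ, E k * (y : ℂ) ^ (-(s + a + a' - c + 2 * k))) ∧
      ∀ k : ℕ, E k * ((Complex.Gamma (s + 2 * k - b))⁻¹ *
          (Complex.Gamma (s + 2 * k + a + a' - c))⁻¹ *
          (Complex.Gamma (s + 2 * k + a + b' - c))⁻¹) =
        D k * ((Complex.Gamma (s + 2 * k))⁻¹ * (Complex.Gamma (s + 2 * k + a + a' + b' - c))⁻¹ *
          (Complex.Gamma (s + 2 * k + a - b))⁻¹) := by
  set K := msmKernel a a' b b' c with hK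
  set ψ : ℕ → ℂ := fun k => ∫ u in Ioi (1 : ℝ), K u * (u : ℂ) ^ (-(s + 2 * k)) with hψ
  have hG := Complex.Gamma_ne_zero_of_re_pos hc
  obtain ⟨J, hint', hJ⟩ : ∃ J : ℝ,
      (∀ k : ℕ, D k ≠ 0 →
        IntegrableOn (fun u : ℝ => K u * (u : ℂ) ^ (-(s + 2 * k))) (Ioi 1)) ∧
      ∀ k : ℕ, D k ≠ 0 → ∫ u in Ioi (1 : ℝ), ‖K u * (u : ℂ) ^ (-(s + 2 * k))‖ ≤ J := by
    by_cases hall : ∀ k, D k = 0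
    · exact ⟨0, fun k hk => absurd (hall k) hk, fun k hk => absurd (hall k) hk⟩
    push Not at hall
    classical
    set k₀ := Nat.find hall with hk₀
    have h0 : D k₀ ≠ 0 := Nat.find_spec hall
    have hlt : ∀ k < k₀, D k = 0 := fun k hk => not_not.1 (Nat.find_min hall hk)
    obtain ⟨M, hM, R, hle⟩ := exists_norm_leading_le hD s h0 hlt
    have hyc : (x : ℂ) ≠ 0 := by exact_mod_cast hx.ne'
    -- Some moment converges: the closed evaluation applies once the real part of the exponent is
    -- large.
    obtain ⟨S, hS⟩ : ∃ S : ℂ, IntegrableOn (fun u : ℝ => K u * (u : ℂ) ^ (-S)) (Ioi 1) := by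
      set T : ℝ := ‖a‖ + ‖b‖ + ‖a'‖ + ‖c - b'‖ + 3 + ‖c‖ with hT
      have hp : 0 ≤ ‖a‖ + ‖b‖ + ‖a'‖ + ‖c - b'‖ := by positivity
      have hcre := Complex.re_le_norm c
      refine ⟨T - a - a', (integrable_and_integral_msmKernel hc ?_ ?_).1⟩
      · simp
        linarith
      · simp
        linarith [norm_nonneg c]
    have hx0 : 0 < ‖(x : ℂ) ^ (-(s + 2 * (k₀ : ℂ)))‖ := by
      rw [Complex.norm_cpow_eq_rpow_re_of_pos hx]; positivity
    have hlead : IntegrableOn (fun u : ℝ => K u * (u : ℂ) ^ (-(s + 2 * k₀))) (Ioi 1) := by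
      refine integrableOn_mul_cpow_of_le (f := fun u => f (x * u))
        (M := M / ‖(x : ℂ) ^ (-(s + 2 * (k₀ : ℂ)))‖) (R := max 1 (R / x)) hS (le_max_left _ _)
        (by positivity) (fun u hu => ?_) (integrableOn_msmKernel_mul hx hint)
      have hu0 : 0 < u := by linarith [(le_max_left _ _).trans hu]
      have hxu : R ≤ x * u := by
        have := (le_max_right _ _).trans hu
        rwa [div_le_iff₀ hx, mul_comm] at this
      have h1 := hle (x * u) hxu (by positivity)
      rw [← hf _ (by positivity), Complex.ofReal_mul,
        Complex.mul_cpow_ofReal_nonneg hx.le hu0.le, norm_mul] at h1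
      rw [div_mul_eq_mul_div, le_div_iff₀ hx0, mul_comm]
      exact h1
    have hre : ∀ k : ℕ, D k ≠ 0 → (s + 2 * k₀).re ≤ (s + 2 * k).re := by
      intro k hk
      have h1 : k₀ ≤ k := by
        by_contra h
        exact hk (hlt k (not_le.1 h))
      simpa using h1
    -- Since `u > 1`, raising the exponent only decreases the norm, so the leading absolute moment
    -- bounds all the others.
    refine ⟨∫ u in Ioi (1 : ℝ), ‖K u * (u : ℂ) ^ (-(s + 2 * k₀))‖,
      fun k hk => integrableOn_mul_cpow_neg (hre k hk) hlead, fun k hk => ?_⟩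
    exact setIntegral_mono_on (integrableOn_mul_cpow_neg (hre k hk) hlead).norm hlead.norm
      measurableSet_Ioi fun u hu => norm_mul_cpow_neg_le K hu (hre k hk)
  refine ⟨fun k => D k * ψ k / Complex.Gamma c, ?_, ?_, ?_⟩
  · refine hD.of_norm_le (M := J / ‖Complex.Gamma c‖) fun k => ?_
    by_cases h : D k = 0
    · simp [h]
    · have h1 : ‖ψ k‖ ≤ J := (norm_integral_le_integral_norm _).trans (hJ k h)
      rw [norm_div, norm_mul, div_mul_eq_mul_div, mul_comm]
      gcongr
  · intro y hy
    have hyc : (y : ℂ) ≠ 0 := by exact_mod_cast hy.ne'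
    have h1 : ∫ u in Ioi (1 : ℝ), K u * f (y * u) =
        ∫ u in Ioi (1 : ℝ), K u * ∑' k : ℕ, D k * ((y * u : ℝ) : ℂ) ^ (-(s + 2 * k)) := by
      refine setIntegral_congr_fun measurableSet_Ioi fun u hu => ?_
      have hu1 : 1 < u := hu
      rw [hf _ (by positivity)]
    rw [rightMSMIntegral_eq _ _ _ _ _ _ hy, h1, integral_mul_tsum_cpow hD hint' hJ hy,
      ← tsum_mul_left]
    refine tsum_congr fun k => ?_
    rw [show -(s + a + a' - c + 2 * (k : ℂ)) = (-a' + c - a) + -(s + 2 * k) by ring,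
      Complex.cpow_add _ _ hyc]
    ring
  · intro k
    by_cases h : D k = 0
    · simp [h]
    · have h1 := integral_msmKernel_mul_inv_Gamma hc (hint' k h)
      change ψ k * _ = _ at h1
      change D k * ψ k / Complex.Gamma c * _ = _
      rw [mul_div_assoc, mul_assoc, div_mul_eq_mul_div, h1]
      field_simp

/-! ### The image formula for the generalized Struve function. -/

theorem cpow_mul_genStruve (a : ℕ) (p b c ρ μ : ℂ) (η α : ℝ) {t : ℝ} (ht : 0 < t) :
    (t : ℂ) ^ (-ρ) * genStruve a p b c η α μ (1 / (t : ℂ)) =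
      ∑' k : ℕ, struveCoeff a c μ (p / (η : ℂ) + (b + 2) / 2) α k * (1 / 4) ^ k /
        (2 : ℂ) ^ (p + 1) * (t : ℂ) ^ (-(ρ + p + 1 + 2 * k)) := by
  have htc : (t : ℂ) ≠ 0 := by exact_mod_cast ht.ne'
  rw [genStruve, ← tsum_mul_left]
  refine tsum_congr fun k => ?_
  have h1 : (1 : ℂ) / t / 2 = (((t * 2 : ℝ) : ℂ))⁻¹ := by push_cast; field_simp
  have harg : ((t * 2 : ℝ) : ℂ).arg ≠ Real.pi := by
    rw [Complex.arg_ofReal_of_nonneg (by positivity)]; exact Real.pi_pos.ne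
  have h2 : (2 : ℂ) ^ (2 * (k : ℂ) + p + 1) = 4 ^ k * 2 ^ (p + 1) := by
    rw [add_assoc, Complex.cpow_add _ _ two_ne_zero]
    rw [Complex.cpow_mul_nat]
    norm_num
  rw [h1, Complex.inv_cpow _ _ harg, Complex.ofReal_mul,
    Complex.mul_cpow_ofReal_nonneg ht.le (by norm_num), Complex.ofReal_ofNat, h2,
    show -(ρ + p + 1 + 2 * (k : ℂ)) = -ρ + -(2 * k + p + 1) by ring,
    Complex.cpow_add (-ρ) (-(2 * k + p + 1)) htc, Complex.cpow_neg _ (2 * (k : ℂ) + p + 1),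
    struveCoeff,
    show (a : ℂ) * k + (p / η + (b + 2) / 2) = a * k + p / η + (b + 2) / 2 by ring, mul_inv,
    mul_inv, div_pow, one_pow]
  ring

/-- For `re γ ≥ -1` the truncation in `toNat` is harmless; the inequality makes the order `-γ + n`
of the inner integral have positive real part. -/
theorem lt_msmOrder {γ : ℂ} (hγ : -1 ≤ γ.re) : γ.re < msmOrder γ := by
  have h1 : -1 ≤ ⌊γ.re⌋ := Int.le_floor.2 (by exact_mod_cast hγ)
  have h2 : ((msmOrder γ : ℕ) : ℤ) = ⌊γ.re⌋ + 1 := Int.toNat_of_nonneg (by omega)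
  have h3 : ((msmOrder γ : ℕ) : ℝ) = ⌊γ.re⌋ + 1 := by exact_mod_cast h2
  rw [h3]
  exact Int.lt_floor_add_one _

theorem FoxWrightDefined.Gamma_ne_zero {m : ℕ} {A : Fin m → ℂ × ℝ} (hA : FoxWrightDefined A)
    (i : Fin m) (k : ℕ) : Complex.Gamma ((A i).1 + ((A i).2 : ℂ) * k) ≠ 0 :=
  Complex.Gamma_ne_zero (hA i k)

/-- The upper pair `(1, 1)` contributes `Γ(1 + k) = k!`, which cancels the factorial of the series.
-/
theorem foxWrightTerm_struve (lam lam' ξ ξ' γ ρ p b μ : ℂ) (a : ℕ) (η α : ℝ) (z : ℂ) (k : ℕ) :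
    foxWrightTerm (struveUpper lam lam' ξ ξ' γ ρ p)
        (struveLower lam lam' ξ ξ' γ ρ a p b η α μ) z k =
      Complex.Gamma (ξ' + ρ + p + 1 + 2 * k) *
        Complex.Gamma (-lam - lam' + γ + ρ + p + 1 + 2 * k) *
        Complex.Gamma (-lam' - ξ + γ + ρ + p + 1 + 2 * k) /
        (Complex.Gamma (μ + α * k) * Complex.Gamma (p / (η : ℂ) + (b + 2) / 2 + a * k) *
          Complex.Gamma (ρ + p + 1 + 2 * k) * Complex.Gamma (-lam' + ξ' + ρ + p + 1 + 2 * k) *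
          Complex.Gamma (-lam - lam' - ξ + γ + ρ + p + 1 + 2 * k)) * z ^ k := by
  have h1 : Complex.Gamma (1 + k) = k.factorial := by
    rw [add_comm, Complex.Gamma_nat_eq_factorial]
  have h2 : (k.factorial : ℂ) ≠ 0 := by exact_mod_cast k.factorial_ne_zero
  simp only [foxWrightTerm, Fin.prod_univ_four, Fin.prod_univ_five, struveUpper, struveLower,
    Matrix.cons_val, Complex.ofReal_one, one_mul, h1, Complex.ofReal_ofNat, Complex.ofReal_natCast]
  field_simp

theorem theorem4 (lam lam' ξ ξ' γ ρ p b c μ : ℂ) (a : ℕ) (η α : ℝ) (hη : 0 < η) (hα : 0 < α)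
    (hγ : -1 ≤ γ.re) (x : ℝ) (hx : 0 < x)
    (hleft : ∀ᶠ y in 𝓝 x, RightMSMDerivIntegrable lam lam' ξ ξ' γ
      (fun t : ℝ => (t : ℂ) ^ (-ρ) * genStruve a p b c η α μ (1 / (t : ℂ))) y)
    (hright : FoxWrightDefined (struveUpper lam lam' ξ ξ' γ ρ p)) :
    ContDiffAt ℝ (msmOrder γ)
        (rightMSMDerivIntegral lam lam' ξ ξ' γ
          (fun t : ℝ => (t : ℂ) ^ (-ρ) * genStruve a p b c η α μ (1 / (t : ℂ)))) x ∧
      Summable (foxWrightTerm (struveUpper lam lam' ξ ξ' γ ρ p)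
        (struveLower lam lam' ξ ξ' γ ρ a p b η α μ) (-c / (4 * (x : ℂ) ^ 2))) ∧
      rightMSMDeriv lam lam' ξ ξ' γ
          (fun t : ℝ => (t : ℂ) ^ (-ρ) * genStruve a p b c η α μ (1 / (t : ℂ))) x =
        (x : ℂ) ^ (lam + lam' - γ - ρ - p - 1) / (2 : ℂ) ^ (p + 1) *
          foxWright (struveUpper lam lam' ξ ξ' γ ρ p)
            (struveLower lam lam' ξ ξ' γ ρ a p b η α μ) (-c / (4 * (x : ℂ) ^ 2)) := by
  set n := msmOrder γ with hn
  set s : ℂ := ρ + p + 1 with hs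
  set D : ℕ → ℂ := fun k => struveCoeff a c μ (p / (η : ℂ) + (b + 2) / 2) α k * (1 / 4) ^ k /
    (2 : ℂ) ^ (p + 1) with hDdef
  have h2p : (2 : ℂ) ^ (p + 1) ≠ 0 := by simp [Complex.cpow_eq_zero_iff]
  have hD : EntireCoeff D := by
    refine (entireCoeff_struveCoeff a c μ (p / (η : ℂ) + (b + 2) / 2) hα).of_norm_le
      (M := ‖(2 : ℂ) ^ (p + 1)‖⁻¹) fun k => ?_
    have h1 : ‖((1 : ℂ) / 4) ^ k‖ ≤ 1 := by
      rw [norm_pow]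
      exact pow_le_one₀ (norm_nonneg _) (by norm_num)
    rw [hDdef, norm_div, norm_mul, div_eq_inv_mul]
    gcongr
    exact mul_le_of_le_one_right (norm_nonneg _) h1
  have hC : 0 < (-γ + (n : ℂ)).re := by
    have := lt_msmOrder hγ
    simp
    linarith
  obtain ⟨E, hE, hI, hEk⟩ := rightMSMIntegral_tsum (a := -lam') (a' := -lam) (b := -ξ')
    (b' := -ξ + n) hC hD (s := s)
    (f := fun t : ℝ => (t : ℂ) ^ (-ρ) * genStruve a p b c η α μ (1 / (t : ℂ)))
    (fun t ht => cpow_mul_genStruve a p b c ρ μ η α ht) hx hleft.self_of_nhds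
  set e : ℂ := s + -lam' + -lam - (-γ + n) with he
  have hxc : (x : ℂ) ≠ 0 := by exact_mod_cast hx.ne'
  have hev : rightMSMDerivIntegral lam lam' ξ ξ' γ
      (fun t : ℝ => (t : ℂ) ^ (-ρ) * genStruve a p b c η α μ (1 / (t : ℂ))) =ᶠ[𝓝 x]
      fun y : ℝ => ∑' k : ℕ, E k * (y : ℂ) ^ (-(e + 2 * k)) := by
    filter_upwards [isOpen_Ioi.mem_nhds hx] with y hy
    exact hI y hy
  set z : ℂ := -c / (4 * (x : ℂ) ^ 2) with hz
  set P : ℂ := (x : ℂ) ^ (lam + lam' - γ - ρ - p - 1) / (2 : ℂ) ^ (p + 1) with hP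
  have hP0 : P ≠ 0 := div_ne_zero (by simp [Complex.cpow_eq_zero_iff, hxc]) h2p
  -- The sign in `(-d/dx)^n` cancels the one from differentiating negative powers.
  have hterm : ∀ k : ℕ, (-1) ^ n * ((E k * ((-1) ^ n * poch (e + 2 * k) n)) *
      (x : ℂ) ^ (-(e + n + 2 * k))) = P * foxWrightTerm (struveUpper lam lam' ξ ξ' γ ρ p)
        (struveLower lam lam' ξ ξ' γ ρ a p b η α μ) z k := by
    intro k
    -- `Complex.Gamma` is `0` at its poles, so these nonvanishing facts are needed to clear the
    -- reciprocal factors in `hk`.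
    have g1 := hright.Gamma_ne_zero 1 k
    have g2 := hright.Gamma_ne_zero 2 k
    have g3 := hright.Gamma_ne_zero 3 k
    simp only [struveUpper, Matrix.cons_val, Complex.ofReal_ofNat] at g1 g2 g3
    have hk := hEk k
    rw [show s + 2 * (k : ℂ) + -lam' + -lam - (-γ + n) = e + 2 * k by rw [he]; ring,
      inv_Gamma_eq_poch_mul (e + 2 * k) n,
      show e + 2 * (k : ℂ) + n = -lam - lam' + γ + ρ + p + 1 + 2 * k by rw [he, hs]; ring,
      show s + 2 * (k : ℂ) - -ξ' = ξ' + ρ + p + 1 + 2 * k by rw [hs]; ring,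
      show s + 2 * (k : ℂ) + -lam' + (-ξ + n) - (-γ + n) = -lam' - ξ + γ + ρ + p + 1 + 2 * k by
        rw [hs]; ring,
      show s + 2 * (k : ℂ) + -lam' + -lam + (-ξ + n) - (-γ + n) =
        -lam - lam' - ξ + γ + ρ + p + 1 + 2 * k by rw [hs]; ring,
      show s + 2 * (k : ℂ) + -lam' - -ξ' = -lam' + ξ' + ρ + p + 1 + 2 * k by rw [hs]; ring] at hk
    have hpow : (x : ℂ) ^ (-(e + n + 2 * k)) =
        (x : ℂ) ^ (lam + lam' - γ - ρ - p - 1) * (((x : ℂ) ^ 2)⁻¹) ^ k := by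
      rw [show -(e + n + 2 * (k : ℂ)) = (lam + lam' - γ - ρ - p - 1) + -(2 * k) by
        rw [he, hs]; ring, Complex.cpow_add _ _ hxc, Complex.cpow_neg _ (2 * (k : ℂ)),
        Complex.cpow_mul_nat, inv_pow]
      norm_num
    have hsign : ((-1 : ℂ) ^ n) * (-1) ^ n = 1 := by rw [← mul_pow]; simp
    have hEp : E k * poch (e + 2 * k) n = D k *
        (Complex.Gamma (ξ' + ρ + p + 1 + 2 * k) *
          Complex.Gamma (-lam - lam' + γ + ρ + p + 1 + 2 * k) *
          Complex.Gamma (-lam' - ξ + γ + ρ + p + 1 + 2 * k)) *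
        ((Complex.Gamma (s + 2 * k))⁻¹ *
          (Complex.Gamma (-lam - lam' - ξ + γ + ρ + p + 1 + 2 * k))⁻¹ *
          (Complex.Gamma (-lam' + ξ' + ρ + p + 1 + 2 * k))⁻¹) := by
      rw [mul_right_comm, ← hk]
      field_simp
    have hzk : (-c / (4 * (x : ℂ) ^ 2)) ^ k = (-c) ^ k * (1 / 4) ^ k * (((x : ℂ) ^ 2)⁻¹) ^ k := by
      rw [← mul_pow, ← mul_pow]
      congr 1
      field_simp
    rw [foxWrightTerm_struve, hpow, hP, hz]
    calc _ = ((-1 : ℂ) ^ n * (-1) ^ n) * (E k * poch (e + 2 * k) n) *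
          ((x : ℂ) ^ (lam + lam' - γ - ρ - p - 1) * (((x : ℂ) ^ 2)⁻¹) ^ k) := by ring
      _ = _ := by
          rw [hsign, hEp, hDdef]
          simp only [struveCoeff]
          rw [add_comm ((α : ℂ) * k) μ, add_comm ((a : ℂ) * k), hzk, hs]
          ring
  -- The Fox–Wright series is, up to the nonzero factor `P`, the differentiated series, and inherits
  -- its convergence.
  have hsumm : Summable fun k : ℕ => P * foxWrightTerm (struveUpper lam lam' ξ ξ' γ ρ p)
        (struveLower lam lam' ξ ξ' γ ρ a p b η α μ) z k := by
    simp only [← hterm]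
    exact ((hE.mul_poch e n).summable_norm (e + n) hx).of_norm.mul_left _
  refine ⟨?_, (summable_mul_left_iff hP0).1 hsumm, ?_⟩
  · exact ((hE.contDiffOn e n).contDiffAt (isOpen_Ioi.mem_nhds hx)).congr_of_eventuallyEq hev
  · rw [rightMSMDeriv, hev.iteratedDeriv_eq, hE.iteratedDeriv_eq e _ hx, ← tsum_mul_left,
      foxWright, ← tsum_mul_left]
    exact tsum_congr hterm

end
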